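/- Let $C$ be a field of characteristic zero, $\bar C\supseteq C$ an algebraically closed field, and for $\alpha\in\bar C$ put $\bar C[[[x-\alpha]]]=\bigcup_{\nu\in C}(x-\alpha)^\nu\,\bar C[[x-\alpha]][\log(x-\alpha)]$. Let $\iota\colon C/\mathbb Z\times\mathbb N\to C$ satisfy $\iota(\nu+\mathbb Z,j)\in\nu+\mathbb Z$, $\iota(\nu_1+\mathbb Z,j_1)+\iota(\nu_2+\mathbb Z,j_2)-\iota(\nu_1+\nu_2+\mathbb Z,j_1+j_2)\in\mathbb N$ and $\iota(\mathbb Z,0)=0$, where $\mathbb N=\{0,1,2,\dots\}$. A series $f\in\bar C[[[x-\alpha]]]$ is *integral* if $\mu-\iota(\mu+\mathbb Z,j)\in\mathbb N$ for every term $(x-\alpha)^\mu\log(x-\alpha)^j$ occurring in $f$ with nonzero coefficient. Let $L=\ell_0+\cdots+\ell_rD^r\in C[x][D]$, $\ell_r\ne0$, be *regular*: for every $\alpha\in\bar C$ it has $r$ solutions in $\bar C[[[x-\alpha]]]$ that are linearly independent over $\bar C$. In $\bar C(x)[D]/\langle L\rangle$, with $\langle L\rangle=\bar C(x)[D]L$,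 the order of an element is the least order of an operator representing it. An element $P$ is *integral* if $P\cdot f$ is integral for every $\alpha\in\bar C$ and every solution $f\in\bar C[[[x-\alpha]]]$ of $L$; the set of integral elements is denoted $\mathcal O_L$. Let $1\le d\le r-1$, and let $B_0,\dots,B_{d-1}$ be elements of $\bar C(x)[D]/\langle L\rangle$ represented by operators in $C(x)[D]$, with $\operatorname{ord}(B_i)=i$ for all $i$, which form a $\bar C[x]$-module basis of $\{A\in\mathcal O_L:\operatorname{ord}(A)<d\}$. For $Y\in\bar C(x)[D]/\langle L\rangle$ put $$E(Y)=\{A\in\mathcal O_L:\operatorname{ord}(A)\le d\}\setminus\bigl(\bar C[x]B_0+\cdots+\bar C[x]B_{d-1}+\bar C[x]Y\bigr).$$ Let $B_d$ be a value obtained in the $d$-th iteration of the integral basis algorithm, that is: let $s\in C[x]$ be the squarefree part of $\ell_r$ (a squarefree divisor of $\ell_r$ divisible by every irreducible factor of $\ell_r$); start with $B_d:=sDB_{d-1}$ or $B_d:=s^dD^dB_0$, and then finitely many times (possibly zero) replace $B_d$ by some element of $E(B_d)$ of the form $\frac1q(c_0B_0+\cdots+c_{d-1}B_{d-1}+B_d)$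 with $c_0,\dots,c_{d-1},q\in C[x]$, $q\neq0$. Suppose that $B_0,\dots,B_d$ do not generate all integral elements of order at most $d$, i.e. $E:=E(B_d)\ne\emptyset$. Then there is an element $A\in E$ of the form $$A=\frac1p\bigl(a_0B_0+\cdots+a_{d-1}B_{d-1}+B_d\bigr),$$ where $p\in C[x]$ is an irreducible factor of $\ell_r$ and $a_0,\dots,a_{d-1}\in C[x]$ satisfy $\deg(a_i)<\deg(p)$ for all $i$. -/

import Mathlib

open Polynomial

noncomputable section

/-! ## The derivation `d/dx` on rational functions -/

/-- The derivative of a rational function, by the quotient rule. -/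
def ratDeriv {K : Type*} [Field K] (f : RatFunc K) : RatFunc K :=
  algebraMap K[X] (RatFunc K) (derivative f.num * f.denom - f.num * derivative f.denom) /
    (algebraMap K[X] (RatFunc K) f.denom) ^ 2

theorem ratDeriv_div {K : Type*} [Field K] (p q : K[X]) (hq : q ≠ 0) :
    ratDeriv (algebraMap K[X] (RatFunc K) p / algebraMap K[X] (RatFunc K) q) =
      algebraMap K[X] (RatFunc K) (derivative p * q - p * derivative q) /
        (algebraMap K[X] (RatFunc K) q) ^ 2 := by
  set f := algebraMap K[X] (RatFunc K) p / algebraMap K[X] (RatFunc K) q with hf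
  have h1 : f.num * q = p * f.denom := (RatFunc.num_mul_eq_mul_denom_iff hq).2 hf
  have h2 := congrArg derivative h1
  simp only [derivative_mul] at h2
  have hd : f.denom ≠ 0 := f.denom_ne_zero
  have hq' : algebraMap K[X] (RatFunc K) q ≠ 0 := RatFunc.algebraMap_ne_zero hq
  have hd' : algebraMap K[X] (RatFunc K) f.denom ≠ 0 := RatFunc.algebraMap_ne_zero hd
  rw [ratDeriv, div_eq_div_iff (pow_ne_zero 2 hd') (pow_ne_zero 2 hq')]
  simp only [← map_pow, ← map_mul]
  congr 1
  linear_combination (f.denom * q) * h2 - (derivative q * f.denom + q * derivative f.denom) * h1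

theorem ratDeriv_add {K : Type*} [Field K] (f g : RatFunc K) :
    ratDeriv (f + g) = ratDeriv f + ratDeriv g := by
  induction f using RatFunc.induction_on with | f p q hq =>
  induction g using RatFunc.induction_on with | f p' q' hq' =>
  have h1 := RatFunc.algebraMap_ne_zero hq
  have h2 := RatFunc.algebraMap_ne_zero hq'
  rw [div_add_div _ _ h1 h2]
  simp only [← map_mul, ← map_add]
  rw [ratDeriv_div _ _ hq, ratDeriv_div _ _ hq', ratDeriv_div _ _ (mul_ne_zero hq hq')]
  simp only [map_mul, map_add, map_sub, derivative_mul]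
  field_simp
  ring

theorem ratDeriv_mul {K : Type*} [Field K] (f g : RatFunc K) :
    ratDeriv (f * g) = f * ratDeriv g + g * ratDeriv f := by
  induction f using RatFunc.induction_on with | f p q hq =>
  induction g using RatFunc.induction_on with | f p' q' hq' =>
  have h1 := RatFunc.algebraMap_ne_zero hq
  have h2 := RatFunc.algebraMap_ne_zero hq'
  rw [div_mul_div_comm]
  simp only [← map_mul]
  rw [ratDeriv_div _ _ hq, ratDeriv_div _ _ hq', ratDeriv_div _ _ (mul_ne_zero hq hq')]
  simp only [map_mul, map_add, map_sub, derivative_mul]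
  field_simp
  ring

/-- An additive map satisfying the product rule makes a commutative ring a differential ring. -/
@[reducible]
def differentialOfLeibniz {R : Type*} [CommRing R] (δ : R → R)
    (hadd : ∀ f g, δ (f + g) = δ f + δ g) (hmul : ∀ f g, δ (f * g) = f * δ g + g * δ f) :
    Differential R where
  deriv := Derivation.mk' (AddMonoidHom.mk' δ hadd).toIntLinearMap hmul

/-- The derivation `d/dx` of `K(x)`, extending the derivation of polynomials. -/
instance ratFuncDifferential {K : Type*} [Field K] : Differential (RatFunc K) :=
  differentialOfLeibniz ratDeriv ratDeriv_add ratDeriv_mul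

/-! ## Differential operators -/

/-- Formal differential operators `∑ ℓᵢ Dⁱ` with coefficients `ℓᵢ ∈ F` on the left.  The underlying
type is that of polynomials in the indeterminate `D`; the multiplication (for a differential ring
`F`) is defined below and is not that of polynomials. -/
def DiffOp (F : Type*) [Semiring F] : Type _ := F[X]

namespace DiffOp

instance {F : Type*} [Ring F] : AddCommGroup (DiffOp F) := inferInstanceAs (AddCommGroup F[X])

instance {F S : Type*} [Ring F] [Semiring S] [Module S F] : Module S (DiffOp F) :=
  inferInstanceAs (Module S F[X])

/-- The polynomial `∑ ℓᵢ Xⁱ` recording the coefficients of the operator `∑ ℓᵢ Dⁱ`. -/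
def symbol {F : Type*} [Semiring F] (P : DiffOp F) : F[X] := P

/-- The operator with the given coefficients. -/
def ofSymbol {F : Type*} [Semiring F] (P : F[X]) : DiffOp F := P

/-- The coefficient `ℓᵢ` of `Dⁱ`. -/
def coeff {F : Type*} [Semiring F] (P : DiffOp F) (i : ℕ) : F := P.symbol.coeff i

/-- The order: the largest `i` with `ℓᵢ ≠ 0` (and `0` for the zero operator). -/
def order {F : Type*} [Semiring F] (P : DiffOp F) : ℕ := P.symbol.natDegree

/-- The coefficient of the highest power of `D`. -/
def leadingCoeff {F : Type*} [Semiring F] (P : DiffOp F) : F := P.symbol.leadingCoeff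

/-- Apply a ring homomorphism to all coefficients. -/
def map {F G : Type*} [Semiring F] [Semiring G] (φ : F →+* G) (P : DiffOp F) : DiffOp G :=
  ofSymbol (P.symbol.map φ)

section Ring

variable {F : Type*} [CommRing F] [Differential F]

/-- Left multiplication by `D`, determined by `D f = f D + f'`:
`D (∑ ℓᵢ Dⁱ) = ∑ ℓᵢ' Dⁱ + ∑ ℓᵢ Dⁱ⁺¹`. -/
def leftD : Module.End ℤ F[X] :=
  (Differential.mapCoeffs (A := F)).toLinearMap + LinearMap.mulLeft ℤ X

theorem leftD_apply (q : F[X]) : leftD q = Differential.mapCoeffs q + X * q := rfl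

/-- Left multiplication by `∑ ℓᵢ Dⁱ`. -/
def leftMul (P : F[X]) : Module.End ℤ F[X] :=
  P.sum fun i a => LinearMap.mulLeft ℤ (C a) * leftD ^ i

theorem leftMul_add (P Q : F[X]) : leftMul (P + Q) = leftMul P + leftMul Q := by
  refine sum_add_index P Q _ (fun i => ?_) (fun i a b => ?_)
  · apply LinearMap.ext; intro q; simp
  · apply LinearMap.ext; intro q; simp [add_mul]

theorem leftMul_monomial (i : ℕ) (a : F) :
    leftMul (monomial i a) = LinearMap.mulLeft ℤ (C a) * leftD ^ i := by
  refine sum_monomial_index a _ ?_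
  apply LinearMap.ext; intro q; simp

theorem leftMul_zero : leftMul (0 : F[X]) = 0 := by simp [leftMul]

theorem leftD_C_mul (a : F) (q : F[X]) :
    leftD (C a * q) = C (Differential.deriv a) * q + C a * leftD q := by
  simp only [leftD_apply, Derivation.leibniz, Differential.mapCoeffs_C, smul_eq_mul]
  ring

theorem leftMul_C_mul (a : F) (P : F[X]) :
    leftMul (C a * P) = LinearMap.mulLeft ℤ (C a) * leftMul P := by
  induction P using Polynomial.induction_on' with
  | add p q hp hq => rw [mul_add, leftMul_add, hp, hq, leftMul_add, mul_add]
  | monomial i b =>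
    rw [C_mul_monomial, leftMul_monomial, leftMul_monomial, ← mul_assoc]
    apply LinearMap.ext; intro q; simp [mul_assoc]

theorem leftMul_leftD (Q : F[X]) : leftMul (leftD Q) = leftD * leftMul Q := by
  induction Q using Polynomial.induction_on' with
  | add p q hp hq => rw [map_add, leftMul_add, hp, hq, leftMul_add, mul_add]
  | monomial i b =>
    rw [leftD_apply, leftMul_add, Differential.mapCoeffs_monomial, X_mul_monomial,
      leftMul_monomial, leftMul_monomial, leftMul_monomial]
    apply LinearMap.ext; intro q
    have h := leftD_C_mul b ((leftD ^ i) q)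
    simp only [LinearMap.add_apply, Module.End.mul_apply, LinearMap.mulLeft_apply, h,
      pow_succ']

theorem leftMul_mul (P Q : F[X]) : leftMul (leftMul P Q) = leftMul P * leftMul Q := by
  induction P using Polynomial.induction_on' with
  | add p q hp hq =>
    rw [leftMul_add, LinearMap.add_apply, leftMul_add, hp, hq, add_mul]
  | monomial i b =>
    rw [leftMul_monomial, Module.End.mul_apply, LinearMap.mulLeft_apply, leftMul_C_mul,
      mul_assoc]
    congr 1
    induction i with
    | zero => simp
    | succ i ih =>
      rw [pow_succ', Module.End.mul_apply, leftMul_leftD, ih, mul_assoc]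

theorem leftMul_one : leftMul (1 : F[X]) = 1 := by
  rw [← monomial_zero_one, leftMul_monomial]
  apply LinearMap.ext; intro q; simp

theorem leftD_pow_one (i : ℕ) : (leftD ^ i) (1 : F[X]) = X ^ i := by
  induction i with
  | zero => simp
  | succ i ih =>
    rw [pow_succ', Module.End.mul_apply, ih, leftD_apply, ← monomial_one_right_eq_X_pow,
      Differential.mapCoeffs_monomial]
    simp [← monomial_one_right_eq_X_pow, X_mul_monomial]

theorem leftMul_apply_one (P : F[X]) : leftMul P 1 = P := by
  induction P using Polynomial.induction_on' with
  | add p q hp hq => rw [leftMul_add, LinearMap.add_apply, hp, hq]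
  | monomial i b =>
    rw [leftMul_monomial, Module.End.mul_apply, leftD_pow_one, LinearMap.mulLeft_apply,
      C_mul_X_pow_eq_monomial]

instance : Mul (DiffOp F) := ⟨fun P Q => ofSymbol (leftMul P.symbol Q.symbol)⟩

instance : One (DiffOp F) := ⟨ofSymbol 1⟩

/-- The ring `F[D]` of differential operators. -/
instance : Ring (DiffOp F) :=
  { (inferInstance : AddCommGroup (DiffOp F)), (inferInstance : Mul (DiffOp F)),
    (inferInstance : One (DiffOp F)) with
    left_distrib := fun P Q R => map_add (leftMul P.symbol) Q.symbol R.symbol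
    right_distrib := fun P Q R => congrArg (fun f => f R.symbol) (leftMul_add P.symbol Q.symbol)
    zero_mul := fun P => congrArg (fun f => f P.symbol) (leftMul_zero (F := F))
    mul_zero := fun P => map_zero (leftMul P.symbol)
    mul_assoc := fun P Q R => congrArg (fun f => f R.symbol) (leftMul_mul P.symbol Q.symbol)
    one_mul := fun P => congrArg (fun f => f P.symbol) (leftMul_one (F := F))
    mul_one := fun P => leftMul_apply_one P.symbol }

/-- The operator `D`. -/
def D : DiffOp F := ofSymbol X

/-- The commutation rule `D f = f D + f'`. -/
theorem D_mul_smul_one (f : F) :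
    (D : DiffOp F) * (f • (1 : DiffOp F)) = f • (D : DiffOp F) + Differential.deriv f • 1 := by
  change leftMul X (f • (1 : F[X])) = f • (X : F[X]) + Differential.deriv f • (1 : F[X])
  rw [← monomial_one_one_eq_X, leftMul_monomial]
  simp only [map_one, pow_one, Module.End.mul_apply, LinearMap.mulLeft_apply, one_mul,
    leftD_apply, smul_eq_C_mul, mul_one, Differential.mapCoeffs_C, monomial_one_one_eq_X]
  ring

instance {S : Type*} [CommSemiring S] [Algebra S F] :
    IsScalarTower S (DiffOp F) (DiffOp F) where
  smul_assoc s P Q := by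
    have h : ∀ T : F[X], s • T = C (algebraMap S F s) * T := fun T => by
      ext i; simp [Algebra.smul_def]
    change leftMul (s • P.symbol) Q.symbol = s • (leftMul P.symbol Q.symbol)
    rw [h, h, leftMul_C_mul]
    rfl

end Ring

end DiffOp

/-! ## Generalized series -/

/-- The generalized series `t ^ exponent * body (log t)`, where `t = x - α` is a local parameter and
`body` is a polynomial in `log t` whose coefficients are formal Laurent series in `t`.  Splitting
off a power of `t`, these are exactly the elements of `⋃ ν ∈ C, t ^ ν K[[t]][log t]`. -/
structure GenSeries (C K : Type*) [Field C] [Field K] where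
  /-- the exponent `ν` -/
  exponent : C
  /-- the polynomial in `log t` over `K((t))` -/
  body : (LaurentSeries K)[X]

/-- The expansion of a rational function at the point `α`, i.e. the image under
`K(x) → K((t))`, `x ↦ α + t`. -/
def expandAt {K : Type*} [Field K] (α : K) : RatFunc K →+* LaurentSeries K :=
  IsFractionRing.lift (A := K[X])
    (g := (algebraMap K[X] (LaurentSeries K)).comp (taylorAlgHom α).toRingHom)
    ((FaithfulSMul.algebraMap_injective K[X] (LaurentSeries K)).comp (taylor_injective α))

/-- For `g(t, log t) ∈ K((t))[log t]` this is `t ^ (-c) * d/dt (t ^ c * g(t, log t))`, that is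
`∂g/∂t + t⁻¹ ∂g/∂(log t) + c t⁻¹ g`. -/
def twistedDeriv {K : Type*} [Field K] (c : K) (g : (LaurentSeries K)[X]) :
    (LaurentSeries K)[X] :=
  (g.sum fun j a => monomial j (LaurentSeries.derivative K a)) +
    C (HahnSeries.single (-1 : ℤ) (1 : K)) * derivative g +
    C (HahnSeries.single (-1 : ℤ) c) * g

namespace GenSeries

variable {C K : Type*} [Field C] [Field K] [Algebra C K]

/-- The coefficient of `t ^ μ * (log t) ^ j`. -/
def coeff (f : GenSeries C K) : C → ℕ → K :=
  Function.extend (fun n : ℤ => f.exponent + (n : C)) (fun n j => (f.body.coeff j).coeff n) 0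

/-- The action of a differential operator with rational function coefficients on a generalized
series in `t = x - α`: coefficients act by multiplication with their expansion at `α`, and `D` acts
as `d/dt`. -/
def act (α : K) (P : DiffOp (RatFunc K)) (f : GenSeries C K) : GenSeries C K where
  exponent := f.exponent
  body := P.symbol.sum fun i a =>
    Polynomial.C (expandAt α a) * (twistedDeriv (algebraMap C K f.exponent))^[i] f.body

/-- `f` is a solution, in `t = x - α`, of the operator `P`. -/
def IsSolution (α : K) (P : DiffOp (RatFunc K)) (f : GenSeries C K) : Prop :=
  (act α P f).body = 0

end GenSeries

/-! ## Integrality -/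

/-- The data `ι : C/ℤ × ℕ → C` on which the notion of integrality depends.  An element of `C` is
`≥ 0` in the sense below if it is a nonnegative integer. -/
structure Threshold (C : Type*) [Field C] where
  /-- the function `ι` -/
  toFun : C ⧸ AddSubgroup.zmultiples (1 : C) → ℕ → C
  mk_toFun : ∀ (ν : C ⧸ AddSubgroup.zmultiples (1 : C)) (j : ℕ),
    QuotientAddGroup.mk (toFun ν j) = ν
  subadditive : ∀ (ν₁ ν₂ : C ⧸ AddSubgroup.zmultiples (1 : C)) (j₁ j₂ : ℕ),
    ∃ n : ℕ, toFun ν₁ j₁ + toFun ν₂ j₂ - toFun (ν₁ + ν₂) (j₁ + j₂) = (n : C)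
  map_zero : toFun 0 0 = 0

/-- A generalized series is integral if every term `t ^ μ (log t) ^ j` occurring in it satisfies
`μ - ι(μ + ℤ, j) ≥ 0`. -/
def GenSeries.IsIntegral {C K : Type*} [Field C] [Field K] (ι : Threshold C)
    (f : GenSeries C K) : Prop :=
  ∀ (μ : C) (j : ℕ), f.coeff μ j ≠ 0 →
    ∃ n : ℕ, μ - ι.toFun (QuotientAddGroup.mk μ) j = (n : C)

/-- `L` is regular: at each point `α` it has as many linearly independent generalized series
solutions (with exponents in `C`) as its order. -/
def IsRegularOp (C : Type*) {K : Type*} [Field C] [Field K] [Algebra C K]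
    (L : DiffOp (RatFunc K)) : Prop :=
  ∀ α : K, ∃ b : Fin L.order → GenSeries C K,
    (∀ i, (b i).IsSolution α L) ∧ LinearIndependent K fun i => (b i).coeff

/-- The left module `K(x)[D] / K(x)[D] L`. -/
abbrev OpQuotient {K : Type*} [Field K] (L : DiffOp (RatFunc K)) : Type _ :=
  DiffOp (RatFunc K) ⧸ Submodule.span (DiffOp (RatFunc K)) ({L} : Set (DiffOp (RatFunc K)))

namespace OpQuotient

variable {K : Type*} [Field K] {L : DiffOp (RatFunc K)}

/-- The residue class of an operator. -/
def mk (P : DiffOp (RatFunc K)) : OpQuotient L := Submodule.Quotient.mk P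

/-- The order of a residue class: the least order of an operator representing it.  (It is the order
of the representative `∑ i < r, pᵢ Dⁱ`, where `r` is the order of `L`.) -/
def ord (A : OpQuotient L) : ℕ := sInf {n | ∃ P : DiffOp (RatFunc K), mk P = A ∧ P.order = n}

/-- The class `A` is integral: `A · f` is integral for all series solutions `f` of `L` at all
points `α`.  (The series `P · f` does not depend on the representative `P` of `A`.) -/
def IsIntegral {C : Type*} [Field C] [Algebra C K] (ι : Threshold C) (A : OpQuotient L) : Prop :=
  ∀ P : DiffOp (RatFunc K), mk P = A →
    ∀ (α : K) (f : GenSeries C K), f.IsSolution α L → (f.act α P).IsIntegral ι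

end OpQuotient

/-! ## The algorithm -/

section Algorithm

variable {C : Type*} (K : Type*) [Field C] [Field K] [Algebra C K]

/-- The inclusion `C[x] → K[x]`. -/
def polyInc : C[X] →+* K[X] := mapRingHom (algebraMap C K)

/-- The inclusion `C(x) → K(x)`. -/
def ratInc : RatFunc C →+* RatFunc K :=
  RatFunc.mapRingHom (polyInc (C := C) K) <|
    nonZeroDivisors_le_comap_nonZeroDivisors_of_injective _
      (map_injective (algebraMap C K) (algebraMap C K).injective)

/-- An operator in `C[x][D]`, regarded as an element of `K(x)[D]`. -/
def baseChange (L : DiffOp C[X]) : DiffOp (RatFunc K) :=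
  L.map ((algebraMap K[X] (RatFunc K)).comp (polyInc K))

variable {K}

/-- `s` is a squarefree part of `ℓ`: a squarefree divisor of `ℓ` divisible by all irreducible factors
of `ℓ`.  It is unique up to nonzero constants. -/
def IsSquarefreePart (s ℓ : C[X]) : Prop :=
  Squarefree s ∧ s ∣ ℓ ∧ ∀ q : C[X], Irreducible q → q ∣ ℓ → q ∣ s

/-- The class lies in the image of `C(x)[D]`. -/
def OpQuotient.DefinedOver (C : Type*) [Field C] [Algebra C K] {L : DiffOp (RatFunc K)}
    (A : OpQuotient L) : Prop :=
  ∃ P : DiffOp (RatFunc C), A = OpQuotient.mk (P.map (ratInc K))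

/-- The element `1/p * (a₀ B₀ + ⋯ + a_{d-1} B_{d-1} + Y)`. -/
def refinement {L : DiffOp (RatFunc K)} (d : ℕ) (B : ℕ → OpQuotient L) (Y : OpQuotient L)
    (p : C[X]) (a : ℕ → C[X]) : OpQuotient L :=
  (algebraMap K[X] (RatFunc K) (polyInc K p))⁻¹ •
    (∑ i ∈ Finset.range d, polyInc K (a i) • B i + Y)

/-- The set `E` of integral elements of order at most `d` which are not in
`K[x] B₀ + ⋯ + K[x] B_{d-1} + K[x] Y`, where `Y` is the current choice for `B_d`. -/
def missing {L : DiffOp (RatFunc K)} (ι : Threshold C) (d : ℕ) (B : ℕ → OpQuotient L)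
    (Y : OpQuotient L) : Set (OpQuotient L) :=
  {A | A.IsIntegral ι ∧ A.ord ≤ d} \
    (Submodule.span K[X] (insert Y (B '' Set.Iio d)) : Set (OpQuotient L))

/-- `IsCurrent ι L s d B Y`: given `B₀, …, B_{d-1}`, the element `Y` occurs as a value of `B_d` during
the `d`-th iteration of the algorithm.  The initial value is `s D B_{d-1}` (or `s ^ d D ^ d B₀`) with
`s` the squarefree part of the leading coefficient of `L`, and as long as `E ≠ ∅` the value is
replaced by some element of `E` of the form `1/p * (a₀ B₀ + ⋯ + a_{d-1} B_{d-1} + B_d)`. -/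
inductive IsCurrent (ι : Threshold C) (L : DiffOp C[X]) (s : C[X]) (d : ℕ)
    (B : ℕ → OpQuotient (baseChange K L)) : OpQuotient (baseChange K L) → Prop
  | init : IsCurrent ι L s d B
      (polyInc K s •
        (DiffOp.D : DiffOp (RatFunc K)) • B (d - 1))
  | init_alt : IsCurrent ι L s d B
      (polyInc K s ^ d •
        (DiffOp.D : DiffOp (RatFunc K)) ^ d • B 0)
  | step (Y : OpQuotient (baseChange K L)) (p : C[X]) (a : ℕ → C[X]) (hY : IsCurrent ι L s d B Y)
      (hp : p ≠ 0) (hE : refinement d B Y p a ∈ missing ι d B Y) :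
      IsCurrent ι L s d B (refinement d B Y p a)

end Algorithm

end

/-! Let `M` be the `K[x]`-span of `B₀, …, B_{d-1}` and `Y = B_d`. After multiplication by a
polynomial, the `D ^ d` coefficient of a missing element `A` can be cancelled by a multiple of `Y`;
what remains is integral of order below `d`, hence a combination of the `Bᵢ`. So `A` is torsion
modulo `M`. As `K` is algebraically closed, some multiple of `A` lies outside `M` while its product
with a suitable `x - α` lies in `M`. Reducing the coefficients of that product modulo `x - α` leaves
an integral element `(x - α)⁻¹ (∑ aᵢ Bᵢ + Y)` with constants `aᵢ ∈ K`
(`exists_simplePole_isIntegral`).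

The point `α` is a root of `ℓ_r`. At an ordinary point the solutions are power series with arbitrary
initial values, so an integral operator of order below `r` has no pole there
(`IntegralAt.coeff_expandAt_eq_zero`). The algorithm keeps the `D ^ d` coefficient of `Y` from
vanishing at ordinary points (`IsCurrent.isCandidate`), so division by `x - α` would create a pole
(`aeval_leadingCoeff_eq_zero`).

It remains to descend from `K` to `C`. The constants `aᵢ` are determined by `α`
(`simplePole_unique`). An automorphism of `K` over `C` fixes `L`, the `Bᵢ` and `Y`, so it carries
the element with pole `α` to one with pole `σ α` (`simplePole_map`). If `σ α = α`, uniqueness gives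
`σ aᵢ = aᵢ`; hence `aᵢ ∈ C(α)`, and `aᵢ` is the value at `α` of a polynomial of degree below that of
the minimal polynomial `p` of `α`. With these polynomials as coefficients, `p⁻¹ (∑ aᵢ Bᵢ + Y)` is
integral at each root `σ α` of `p`, where up to a unit and an integral summand it is the conjugate
element, and elsewhere because `1 / p` has no pole (`refinement_isIntegral`). It lies outside `M`
because `1 / p` is not a polynomial (`refinement_notMem_span`). Since `K` may be transcendental over
`C`, automorphisms are built by way of transcendence bases. -/

/-! ### Automorphisms of an algebraically closed field over a subfield -/

namespace IsAlgClosed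

/-- An automorphism of the polynomial ring on a transcendence basis extends to an algebraically
closed field. -/
theorem exists_ringEquiv_extend {F K ι : Type*} [Field F] [Field K] [Algebra F K] [IsAlgClosed K]
    {v : ι → K} (hv : IsTranscendenceBasis F v) (τ : MvPolynomial ι F ≃+* MvPolynomial ι F) :
    ∃ σ : K ≃+* K, ∀ p, σ (MvPolynomial.aeval v p) = MvPolynomial.aeval v (τ p) := by
  -- `K` is an algebraic closure of the polynomial ring on `v`, and algebraic closures are unique
  -- over any isomorphism of the base.
  let := isAlgClosure_of_transcendence_basis v hv
  let e := hv.1.aevalEquiv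
  let E := (e.symm.toRingEquiv.trans τ).trans e.toRingEquiv
  refine ⟨IsAlgClosure.equivOfEquiv K K E, fun p => ?_⟩
  have h := IsAlgClosure.equivOfEquiv_algebraMap K K E (e p)
  have h1 : ∀ q, algebraMap (Algebra.adjoin F (Set.range v)) K (e q) = MvPolynomial.aeval v q :=
    fun q => hv.1.algebraMap_aevalEquiv q
  have h2 : E (e p) = e (τ p) := by simp [E]
  rw [h2, h1, h1] at h
  exact h

/-- An automorphism of a subfield extends to an algebraically closed field. -/
theorem exists_ringEquiv_extend_field {F K : Type*} [Field F] [Field K] [Algebra F K]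
    [IsAlgClosed K] (τ : F ≃+* F) :
    ∃ σ : K ≃+* K, ∀ a, σ (algebraMap F K a) = algebraMap F K (τ a) := by
  obtain ⟨s, hs⟩ := exists_isTranscendenceBasis F K
  obtain ⟨σ, hσ⟩ := exists_ringEquiv_extend hs (MvPolynomial.mapEquiv s τ)
  refine ⟨σ, fun a => ?_⟩
  simpa using hσ (MvPolynomial.C a)

/-- Roots of the same irreducible polynomial are conjugate in an algebraically closed field, even
when it is not algebraic over the base field. -/
theorem exists_algEquiv_of_root {F K : Type*} [Field F] [Field K] [Algebra F K] [IsAlgClosed K]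
    {x y : K} (hx : IsAlgebraic F x) (hy : aeval y (minpoly F x) = 0) :
    ∃ σ : K ≃ₐ[F] K, σ x = y := by
  have hy' : IsAlgebraic F y := ⟨minpoly F x, minpoly.ne_zero hx.isIntegral, hy⟩
  -- The conjugation takes place in the algebraic closure of `F` inside `K`, which is normal over
  -- `F`; it is extended to `K` afterwards.
  let E := algebraicClosure F K
  have : IsAlgClosure F E := inferInstance
  have : Normal F E := IsAlgClosure.normal F E
  let x' : E := ⟨x, mem_algebraicClosure_iff.2 hx⟩
  let y' : E := ⟨y, mem_algebraicClosure_iff.2 hy'⟩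
  have hx' : IsAlgebraic F x' := isAlgebraic_algebraMap_iff (algebraMap E K).injective |>.1 hx
  have hmin : minpoly F x' = minpoly F x :=
    (minpoly.algebraMap_eq (algebraMap E K).injective x').symm
  have hroot : aeval y' (minpoly F x') = 0 := by
    apply (algebraMap E K).injective
    rw [hmin, ← aeval_algebraMap_apply, map_zero]
    exact hy
  obtain ⟨τ, hτ⟩ := minpoly.exists_algEquiv_of_root' hx' hroot
  obtain ⟨σ, hσ⟩ := exists_ringEquiv_extend_field (K := K) τ.toRingEquiv
  refine ⟨AlgEquiv.ofRingEquiv (f := σ) fun a => ?_, ?_⟩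
  · have := hσ (algebraMap F E a)
    simpa [← IsScalarTower.algebraMap_apply] using this
  · have := hσ x'
    have h3 : τ.toRingEquiv x' = y' := hτ
    rw [h3] at this
    exact this

/-- The fixed field of all automorphisms of an algebraically closed field of characteristic zero
over a subfield is the subfield. -/
theorem mem_range_algebraMap_of_fixed {F K : Type*} [Field F] [CharZero F] [Field K] [Algebra F K]
    [IsAlgClosed K] {x : K} (hx : ∀ σ : K ≃ₐ[F] K, σ x = x) : x ∈ Set.range (algebraMap F K) := by
  by_cases hx' : IsAlgebraic F x
  · have hint := hx'.isIntegral
    -- The minimal polynomial is separable with `x` as its only root, so it is linear.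
    have hroots : ∀ y : K, aeval y (minpoly F x) = 0 → y = x := fun y hy => by
      obtain ⟨σ, hσ⟩ := exists_algEquiv_of_root hx' hy
      rw [← hσ, hx σ]
    have hsep : (minpoly F x).Separable := (minpoly.irreducible hint).separable
    have hcard := card_rootSet_eq_natDegree hsep
      (IsAlgClosed.splits ((minpoly F x).map (algebraMap F K)))
    have hle : Fintype.card ((minpoly F x).rootSet K) ≤ 1 :=
      Fintype.card_le_one_iff.2 fun a b => Subtype.ext <| by
        rw [hroots a (mem_rootSet.1 a.2).2, hroots b (mem_rootSet.1 b.2).2]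
    rw [hcard] at hle
    exact minpoly.natDegree_eq_one_iff.1 (le_antisymm hle (minpoly.natDegree_pos hint))
  · exfalso
    -- A transcendental `x` belongs to a transcendence basis; the shift of all basis variables by
    -- `1` extends to an automorphism sending `x` to `x + 1`.
    have hind : AlgebraicIndepOn F id ({x} : Set K) := by
      refine (algebraicIndependent_unique_type_iff (R := F)
        (x := fun i : ({x} : Set K) => (i : K))).2 ?_
      exact hx'
    obtain ⟨s, hs, hsb⟩ := exists_isTranscendenceBasis_superset hind
    let i : s := ⟨x, hs rfl⟩
    let f : MvPolynomial s F →ₐ[F] MvPolynomial s F :=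
      MvPolynomial.aeval fun j => MvPolynomial.X j + 1
    let g : MvPolynomial s F →ₐ[F] MvPolynomial s F :=
      MvPolynomial.aeval fun j => MvPolynomial.X j - 1
    let τ : MvPolynomial s F ≃ₐ[F] MvPolynomial s F := AlgEquiv.ofAlgHom f g
      (by ext; simp [f, g]) (by ext; simp [f, g])
    obtain ⟨σ, hσ⟩ := exists_ringEquiv_extend hsb τ.toRingEquiv
    have h := hx (AlgEquiv.ofRingEquiv (f := σ) fun a => by
      have := hσ (MvPolynomial.C a)
      rw [show τ.toRingEquiv (MvPolynomial.C a) = MvPolynomial.C a from τ.commutes a] at this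
      simpa using this)
    have h2 := hσ (MvPolynomial.X i)
    have h3 : τ.toRingEquiv (MvPolynomial.X i) = MvPolynomial.X i + 1 := by
      change f _ = _
      simp [f]
    rw [h3] at h2
    simp only [MvPolynomial.aeval_X, map_add, map_one] at h2
    have h4 : σ x = x := h
    simp [i, h4] at h2

end IsAlgClosed

/-! ### Laurent series -/

namespace LaurentSeries

variable {K : Type*} [Field K]

theorem coeff_derivative (f : LaurentSeries K) (n : ℤ) :
    (derivative K f).coeff n = ((n : K) + 1) * f.coeff (n + 1) := by
  simp [hasseDeriv_coeff]

theorem derivative_single_mul (m : ℤ) (a : K) (g : LaurentSeries K) :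
    derivative K (HahnSeries.single m a * g) =
      HahnSeries.single m a * derivative K g + HahnSeries.single (m - 1) ((m : K) * a) * g := by
  ext n
  simp only [coeff_derivative, HahnSeries.coeff_single_mul, HahnSeries.coeff_add]
  rw [show n + 1 - m = n - m + 1 by ring, show n - (m - 1) = n - m + 1 by ring]
  push_cast
  ring

theorem derivative_ofPowerSeries (p : PowerSeries K) :
    derivative K (HahnSeries.ofPowerSeries ℤ K p) =
      HahnSeries.ofPowerSeries ℤ K (PowerSeries.derivative K p) := by
  ext n
  rw [coeff_derivative]
  rcases lt_or_ge n 0 with hn | hn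
  · rcases eq_or_ne n (-1) with rfl | hn1
    · simp [HahnSeries.ofPowerSeries_apply, HahnSeries.embDomain_of_notMem_range]
    · rw [HahnSeries.ofPowerSeries_apply, HahnSeries.ofPowerSeries_apply,
        HahnSeries.embDomain_of_notMem_range (by simp; omega),
        HahnSeries.embDomain_of_notMem_range (by simp; omega), mul_zero]
  · lift n to ℕ using hn
    rw [show ((n : ℤ) + 1) = ((n + 1 : ℕ) : ℤ) by push_cast; ring, coeff_coe_powerSeries,
      coeff_coe_powerSeries, PowerSeries.coeff_derivative]
    push_cast
    ring

/-- Each factor is a power of `t` times a power series, which reduces the product rule to the one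
for power series. -/
theorem derivative_mul (f g : LaurentSeries K) :
    derivative K (f * g) = f * derivative K g + derivative K f * g := by
  have key : ∀ (m : ℤ) (p : PowerSeries K),
      derivative K (HahnSeries.single m 1 * HahnSeries.ofPowerSeries ℤ K p) =
        HahnSeries.single m 1 * HahnSeries.ofPowerSeries ℤ K (PowerSeries.derivative K p) +
          HahnSeries.single (m - 1) (m : K) * HahnSeries.ofPowerSeries ℤ K p := fun m p => by
    rw [derivative_single_mul, derivative_ofPowerSeries, mul_one]
  rw [← single_order_mul_powerSeriesPart f, ← single_order_mul_powerSeriesPart g]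
  set p := f.powerSeriesPart
  set q := g.powerSeriesPart
  rw [mul_mul_mul_comm, HahnSeries.single_mul_single, mul_one, ← map_mul, key, key, key, Derivation.leibniz]
  simp only [map_add, map_mul, smul_eq_mul]
  rw [show f.order + g.order - 1 = (f.order - 1) + g.order by ring]
  have h1 : (HahnSeries.single (f.order - 1 + g.order) (((f.order + g.order : ℤ)) : K)) =
      HahnSeries.single (f.order - 1) (f.order : K) * HahnSeries.single g.order 1 +
      HahnSeries.single f.order 1 * HahnSeries.single (g.order - 1) (g.order : K) := by
    simp only [HahnSeries.single_mul_single, mul_one, one_mul]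
    rw [show f.order - 1 + g.order = f.order + (g.order - 1) by ring]
    rw [← HahnSeries.single_add]
    push_cast
    rfl
  have h2 : (HahnSeries.single (f.order + g.order) (1 : K)) =
      HahnSeries.single f.order 1 * HahnSeries.single g.order 1 := by
    simp
  rw [h1, h2]
  ring

theorem coeff_mul_of_lt {f g : LaurentSeries K} {a b m : ℤ} (hf : ∀ n < a, f.coeff n = 0)
    (hg : ∀ n < b, g.coeff n = 0) (hm : m < a + b) : (f * g).coeff m = 0 := by
  rw [HahnSeries.coeff_mul]
  refine Finset.sum_eq_zero fun x hx => ?_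
  rw [Finset.mem_antidiagonal] at hx
  rcases lt_or_ge x.1 a with h | h
  · rw [hf _ h, zero_mul]
  · rw [hg _ (by omega), mul_zero]

theorem coeff_mul_add {f g : LaurentSeries K} {a b : ℤ} (hf : ∀ n < a, f.coeff n = 0)
    (hg : ∀ n < b, g.coeff n = 0) : (f * g).coeff (a + b) = f.coeff a * g.coeff b := by
  rw [HahnSeries.coeff_mul]
  rw [Finset.sum_eq_single (a, b)]
  · rintro ⟨x, y⟩ hx hne
    rw [Finset.mem_antidiagonal] at hx
    obtain ⟨-, -, hxy⟩ := hx
    rcases lt_trichotomy x a with h | h | h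
    · rw [hf _ h, zero_mul]
    · exact absurd (Prod.ext h (by simp at hxy ⊢; omega)) hne
    · rw [hg _ (by simp at hxy; omega), mul_zero]
  · intro h
    rw [Finset.mem_antidiagonal] at h
    by_contra hne
    exact h ⟨left_ne_zero_of_mul hne, right_ne_zero_of_mul hne, rfl⟩

end LaurentSeries

/-! ### Expansion of rational functions -/

section Expansion

variable {K : Type*} [Field K]

theorem expandAt_algebraMap (α : K) (p : K[X]) :
    expandAt α (algebraMap K[X] (RatFunc K) p) =
      HahnSeries.ofPowerSeries ℤ K ((taylor α p : K[X]) : PowerSeries K) := by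
  rw [expandAt, IsFractionRing.lift_algebraMap]
  simp [Polynomial.algebraMap_hahnSeries_apply]

/-- On polynomials the expansion is a Taylor shift, which commutes with `d/dx`. For quotients, the
product rule is applied to `(p / q) * q = p`. -/
theorem expandAt_ratDeriv (α : K) (f : RatFunc K) :
    expandAt α (ratDeriv f) = LaurentSeries.derivative K (expandAt α f) := by
  have hpoly : ∀ p : K[X], expandAt α (algebraMap K[X] (RatFunc K) (derivative p)) =
      LaurentSeries.derivative K (expandAt α (algebraMap K[X] (RatFunc K) p)) := fun p => by
    rw [expandAt_algebraMap, expandAt_algebraMap, LaurentSeries.derivative_ofPowerSeries]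
    congr 1
    rw [PowerSeries.derivative_coe]
    congr 1
    simp [taylor_apply, derivative_comp]
  induction f using RatFunc.induction_on with | f p q hq =>
  rw [ratDeriv_div _ _ hq]
  have hq' : algebraMap K[X] (RatFunc K) q ≠ 0 := RatFunc.algebraMap_ne_zero hq
  have hE : expandAt α (algebraMap K[X] (RatFunc K) q) ≠ 0 := (_root_.map_ne_zero _).2 hq'
  have h1 := LaurentSeries.derivative_mul (expandAt α (algebraMap K[X] (RatFunc K) p /
    algebraMap K[X] (RatFunc K) q)) (expandAt α (algebraMap K[X] (RatFunc K) q))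
  rw [← map_mul, div_mul_cancel₀ _ hq', ← hpoly, ← hpoly] at h1
  simp only [map_mul, map_sub, map_div₀, map_pow] at h1 ⊢
  rw [h1]
  field_simp
  ring

theorem coeff_expandAt_algebraMap_of_neg (α : K) (p : K[X]) {n : ℤ} (hn : n < 0) :
    (expandAt α (algebraMap K[X] (RatFunc K) p)).coeff n = 0 := by
  rw [expandAt_algebraMap, HahnSeries.ofPowerSeries_apply,
    HahnSeries.embDomain_of_notMem_range (by simp; omega)]

theorem coeff_zero_expandAt_algebraMap (α : K) (p : K[X]) :
    (expandAt α (algebraMap K[X] (RatFunc K) p)).coeff 0 = p.eval α := by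
  rw [expandAt_algebraMap]
  have := LaurentSeries.coeff_coe_powerSeries ((taylor α p : K[X]) : PowerSeries K) 0
  simpa using this

end Expansion

/-! ### The twisted derivative -/

section Twisted

variable {K : Type*} [Field K]

/-- This form turns later identities between series into identities between scalars. -/
theorem coeff_twistedDeriv (c : K) (g : (LaurentSeries K)[X]) (j : ℕ) (n : ℤ) :
    ((twistedDeriv c g).coeff j).coeff n =
      ((n : K) + 1 + c) * (g.coeff j).coeff (n + 1) +
        ((j : K) + 1) * (g.coeff (j + 1)).coeff (n + 1) := by
  have h : (g.sum fun j a => monomial j (LaurentSeries.derivative K a)).coeff j =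
      LaurentSeries.derivative K (g.coeff j) := by
    rw [Polynomial.sum_def, finsetSum_coeff]
    simp only [coeff_monomial]
    rw [Finset.sum_ite_eq']
    split_ifs with h
    · rfl
    · rw [notMem_support_iff.1 h, map_zero]
  have h1 : ((j : LaurentSeries K) + 1) = HahnSeries.single 0 ((j : K) + 1) := by
    rw [HahnSeries.single_add, HahnSeries.single_zero_natCast]; rfl
  rw [twistedDeriv, coeff_add, coeff_add, h, coeff_C_mul, coeff_C_mul, coeff_derivative, h1,
    mul_comm (g.coeff (j + 1))]
  simp only [HahnSeries.coeff_add, LaurentSeries.coeff_derivative, HahnSeries.coeff_single_mul,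
    sub_neg_eq_add, sub_zero]
  ring

/-- The twisted derivative as a linear map. -/
noncomputable def twistedDerivLin (c : K) : Module.End K (LaurentSeries K)[X] where
  toFun := twistedDeriv c
  map_add' f g := by
    ext j n
    simp only [coeff_add, HahnSeries.coeff_add, coeff_twistedDeriv]
    ring
  map_smul' k f := by
    ext j n
    simp only [coeff_smul, HahnSeries.coeff_smul, coeff_twistedDeriv, RingHom.id_apply,
      smul_eq_mul]
    ring

theorem coeff_twistedDerivLin (c : K) (g : (LaurentSeries K)[X]) (j : ℕ) (n : ℤ) :
    ((twistedDerivLin c g).coeff j).coeff n =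
      ((n : K) + 1 + c) * (g.coeff j).coeff (n + 1) +
        ((j : K) + 1) * (g.coeff (j + 1)).coeff (n + 1) :=
  coeff_twistedDeriv c g j n

theorem twistedDerivLin_C_mul (c : K) (u : LaurentSeries K) (g : (LaurentSeries K)[X]) :
    twistedDerivLin c (C u * g) =
      C (LaurentSeries.derivative K u) * g + C u * twistedDerivLin c g := by
  have h : ∀ g : (LaurentSeries K)[X], twistedDerivLin c g =
      (g.sum fun j a => monomial j (LaurentSeries.derivative K a)) +
        C (HahnSeries.single (-1 : ℤ) (1 : K)) * derivative g +
        C (HahnSeries.single (-1 : ℤ) c) * g := fun _ => rfl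
  have h' : ∀ g : (LaurentSeries K)[X], ∀ j,
      (g.sum fun j a => monomial j (LaurentSeries.derivative K a)).coeff j =
      LaurentSeries.derivative K (g.coeff j) := fun g j => by
    rw [Polynomial.sum_def, finsetSum_coeff]
    simp only [coeff_monomial]
    rw [Finset.sum_ite_eq']
    split_ifs with h
    · rfl
    · rw [notMem_support_iff.1 h, map_zero]
  ext1 j
  simp only [h, h', coeff_add, coeff_C_mul, derivative_C_mul, LaurentSeries.derivative_mul]
  ring

theorem derivative_twistedDerivLin (c : K) (g : (LaurentSeries K)[X]) :
    derivative (twistedDerivLin c g) = twistedDerivLin c (derivative g) := by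
  ext j n
  have h1 : ∀ j : ℕ, ((j : LaurentSeries K) + 1) = HahnSeries.single 0 ((j : K) + 1) := fun j => by
    rw [HahnSeries.single_add, HahnSeries.single_zero_natCast]; rfl
  have h2 : ∀ (f : (LaurentSeries K)[X]) (j : ℕ) (n : ℤ), ((derivative f).coeff j).coeff n =
      ((j : K) + 1) * (f.coeff (j + 1)).coeff n := fun f j n => by
    rw [coeff_derivative, h1, mul_comm, HahnSeries.coeff_single_zero_mul]
  rw [h2, coeff_twistedDerivLin, coeff_twistedDerivLin, h2, h2]
  push_cast
  ring

theorem twistedDerivLin_single_mul (c : K) (m : ℤ) (a : K) (g : (LaurentSeries K)[X]) :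
    twistedDerivLin c (C (HahnSeries.single m a) * g) =
      C (HahnSeries.single m a) * twistedDerivLin (c + m) g := by
  ext j n
  simp only [coeff_twistedDerivLin, coeff_C_mul, HahnSeries.coeff_single_mul]
  rw [show n + 1 - m = n - m + 1 by ring]
  push_cast
  ring

end Twisted

/-! ### The action of operators on `K((t))[log t]` -/

section OpAct

variable {K : Type*} [Field K]

/-- Multiplication by a Laurent series. -/
noncomputable def mulSeries (u : LaurentSeries K) : Module.End K (LaurentSeries K)[X] where
  toFun g := C u * g
  map_add' := mul_add _
  map_smul' k g := by
    ext1 j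
    simp only [coeff_C_mul, coeff_smul, RingHom.id_apply, ← HahnSeries.single_zero_mul_eq_smul]
    ring

theorem mulSeries_apply (u : LaurentSeries K) (g : (LaurentSeries K)[X]) :
    mulSeries u g = C u * g := rfl

theorem ofSymbol_add (p q : (RatFunc K)[X]) :
    DiffOp.ofSymbol (p + q) = DiffOp.ofSymbol p + DiffOp.ofSymbol q := rfl

/-- The action of a differential operator on `t ^ c * K((t))[log t]`. -/
noncomputable def opAct (c α : K) (P : DiffOp (RatFunc K)) : Module.End K (LaurentSeries K)[X] :=
  P.symbol.sum fun i a => mulSeries (expandAt α a) * twistedDerivLin c ^ i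

theorem opAct_apply (c α : K) (P : DiffOp (RatFunc K)) (g : (LaurentSeries K)[X]) :
    opAct c α P g = P.symbol.sum fun i a => C (expandAt α a) * (twistedDeriv c)^[i] g := by
  rw [opAct, Polynomial.sum_def, Polynomial.sum_def, LinearMap.sum_apply]
  refine Finset.sum_congr rfl fun i _ => ?_
  rw [Module.End.mul_apply, mulSeries_apply, Module.End.pow_apply]
  rfl

theorem GenSeries.act_body {C : Type*} [Field C] [Algebra C K] (α : K) (P : DiffOp (RatFunc K))
    (f : GenSeries C K) : (f.act α P).body = opAct (algebraMap C K f.exponent) α P f.body :=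
  (opAct_apply _ _ _ _).symm

theorem opAct_add (c α : K) (P Q : DiffOp (RatFunc K)) :
    opAct c α (P + Q) = opAct c α P + opAct c α Q := by
  refine sum_add_index P Q _ (fun i => ?_) (fun i a b => ?_)
  · apply LinearMap.ext; intro q; simp [mulSeries_apply]
  · apply LinearMap.ext; intro q; simp [add_mul, mulSeries_apply]

theorem opAct_monomial (c α : K) (i : ℕ) (a : RatFunc K) :
    opAct c α (DiffOp.ofSymbol (monomial i a)) =
      mulSeries (expandAt α a) * twistedDerivLin c ^ i := by
  refine sum_monomial_index a _ ?_
  apply LinearMap.ext; intro q; simp [mulSeries_apply]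

theorem opAct_zero (c α : K) : opAct c α 0 = 0 :=
  sum_zero_index _

theorem opAct_ofSymbol_C_mul (c α : K) (a : RatFunc K) (P : (RatFunc K)[X]) :
    opAct c α (DiffOp.ofSymbol (C a * P)) =
      mulSeries (expandAt α a) * opAct c α (DiffOp.ofSymbol P) := by
  induction P using Polynomial.induction_on' with
  | add p q hp hq => rw [mul_add, ofSymbol_add, ofSymbol_add, opAct_add, opAct_add, hp, hq, mul_add]
  | monomial i b =>
    rw [C_mul_monomial, opAct_monomial, opAct_monomial, ← mul_assoc]
    apply LinearMap.ext; intro q; simp [mul_assoc, mulSeries_apply]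

theorem opAct_smul (c α : K) (a : RatFunc K) (P : DiffOp (RatFunc K)) :
    opAct c α (a • P) = mulSeries (expandAt α a) * opAct c α P :=
  (congrArg (opAct c α) (smul_eq_C_mul (p := P.symbol) a)).trans
    (opAct_ofSymbol_C_mul c α a P.symbol)

theorem opAct_leftD (c α : K) (Q : (RatFunc K)[X]) :
    opAct c α (DiffOp.ofSymbol (DiffOp.leftD Q)) =
      twistedDerivLin c * opAct c α (DiffOp.ofSymbol Q) := by
  induction Q using Polynomial.induction_on' with
  | add p q hp hq =>
    rw [map_add, ofSymbol_add, ofSymbol_add, opAct_add, opAct_add, hp, hq, mul_add]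
  | monomial i b =>
    rw [DiffOp.leftD_apply, Differential.mapCoeffs_monomial, X_mul_monomial, ofSymbol_add,
      opAct_add, opAct_monomial, opAct_monomial, opAct_monomial]
    apply LinearMap.ext; intro q
    have h1 : expandAt α (Differential.deriv b) = LaurentSeries.derivative K (expandAt α b) :=
      expandAt_ratDeriv α b
    simp only [LinearMap.add_apply, Module.End.mul_apply, mulSeries_apply,
      twistedDerivLin_C_mul, pow_succ', h1]

/-- The substance is `opAct_leftD`: the twisted derivative obeys the commutation rule of `D`. It
follows that every multiple `R * L` kills the solutions of `L`. -/
theorem opAct_mul (c α : K) (P Q : DiffOp (RatFunc K)) :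
    opAct c α (P * Q) = opAct c α P * opAct c α Q := by
  suffices h : ∀ P Q : (RatFunc K)[X], opAct c α (DiffOp.ofSymbol (DiffOp.leftMul P Q)) =
      opAct c α (DiffOp.ofSymbol P) * opAct c α (DiffOp.ofSymbol Q) from h P Q
  intro P Q
  induction P using Polynomial.induction_on' with
  | add p q hp hq =>
    rw [DiffOp.leftMul_add, LinearMap.add_apply, ofSymbol_add, ofSymbol_add, opAct_add, opAct_add,
      hp, hq, add_mul]
  | monomial i b =>
    rw [DiffOp.leftMul_monomial, Module.End.mul_apply, LinearMap.mulLeft_apply, opAct_monomial,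
      opAct_ofSymbol_C_mul, mul_assoc]
    congr 1
    induction i with
    | zero => simp
    | succ i ih =>
      rw [pow_succ', Module.End.mul_apply, pow_succ', mul_assoc, ← ih]
      exact opAct_leftD _ _ _

theorem opAct_D (c α : K) : opAct c α DiffOp.D = twistedDerivLin c := by
  have h := opAct_monomial c α 1 1
  rw [monomial_one_one_eq_X] at h
  rw [DiffOp.D, h]
  apply LinearMap.ext; intro q; simp [mulSeries_apply]

theorem opAct_eq_sum (c α : K) (P : DiffOp (RatFunc K)) {n : ℕ} (hn : P.order < n)
    (g : (LaurentSeries K)[X]) : opAct c α P g =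
      ∑ i ∈ Finset.range n, C (expandAt α (P.coeff i)) * (twistedDerivLin c ^ i) g := by
  rw [opAct, sum_over_range' _ _ _ hn, LinearMap.sum_apply]
  · rfl
  · intro i
    apply LinearMap.ext; intro q; simp [mulSeries_apply]

/-- The derivative here is `d/d(log t)`. It commutes with `D` and with multiplication by Laurent
series, hence maps solutions to solutions. -/
theorem derivative_opAct (c α : K) (P : DiffOp (RatFunc K)) (g : (LaurentSeries K)[X]) :
    derivative (opAct c α P g) = opAct c α P (derivative g) := by
  have h : ∀ i : ℕ, ∀ g, derivative ((twistedDerivLin c ^ i) g) =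
      (twistedDerivLin c ^ i) (derivative g) := fun i => by
    induction i with
    | zero => intro g; rfl
    | succ i ih =>
      intro g
      rw [pow_succ', Module.End.mul_apply, derivative_twistedDerivLin, ih, Module.End.mul_apply]
  rw [opAct_eq_sum c α P (Nat.lt_succ_self _), opAct_eq_sum c α P (Nat.lt_succ_self _),
    derivative_sum]
  simp only [derivative_C_mul, h]

/-- A power of `t` can be moved between the exponent and the body, so a series with integer exponent
can be treated as one with exponent `0`. -/
theorem opAct_single_mul (c α : K) (P : DiffOp (RatFunc K)) (m : ℤ) (a : K) (g : (LaurentSeries K)[X]) :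
    opAct c α P (C (HahnSeries.single m a) * g) =
      C (HahnSeries.single m a) * opAct (c + m) α P g := by
  have h : ∀ i : ℕ, ∀ g, (twistedDerivLin c ^ i) (C (HahnSeries.single m a) * g) =
      C (HahnSeries.single m a) * (twistedDerivLin (c + m) ^ i) g := fun i => by
    induction i with
    | zero => intro g; rfl
    | succ i ih =>
      intro g
      rw [pow_succ', Module.End.mul_apply, ih, twistedDerivLin_single_mul, pow_succ',
        Module.End.mul_apply]
  rw [opAct_eq_sum c α P (Nat.lt_succ_self _), opAct_eq_sum _ α P (Nat.lt_succ_self _),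
    Finset.mul_sum]
  simp only [h]
  refine Finset.sum_congr rfl fun i _ => ?_
  ring

end OpAct

/-! ### Coefficients of powers of `t` -/

section Slice

variable {K : Type*} [Field K]

/-- The coefficient of `t ^ n`, a polynomial in `log t`. -/
noncomputable def slice (n : ℤ) : (LaurentSeries K)[X] →ₗ[K] K[X] where
  toFun g := ∑ j ∈ g.support, monomial j ((g.coeff j).coeff n)
  map_add' f g := by
    ext j
    have h : ∀ g : (LaurentSeries K)[X],
        (∑ j ∈ g.support, monomial j ((g.coeff j).coeff n)).coeff j = (g.coeff j).coeff n :=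
      fun g => by simp +contextual [finsetSum_coeff, coeff_monomial]
    rw [coeff_add, h, h, h, coeff_add, HahnSeries.coeff_add]
  map_smul' k f := by
    ext j
    have h : ∀ g : (LaurentSeries K)[X],
        (∑ j ∈ g.support, monomial j ((g.coeff j).coeff n)).coeff j = (g.coeff j).coeff n :=
      fun g => by simp +contextual [finsetSum_coeff, coeff_monomial]
    rw [RingHom.id_apply, coeff_smul, h, h, coeff_smul, HahnSeries.coeff_smul]

theorem coeff_slice (n : ℤ) (g : (LaurentSeries K)[X]) (j : ℕ) :
    (slice n g).coeff j = (g.coeff j).coeff n := by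
  change (∑ j ∈ g.support, monomial j ((g.coeff j).coeff n)).coeff j = _
  simp +contextual [finsetSum_coeff, coeff_monomial]

theorem eq_zero_of_slice_eq_zero {g : (LaurentSeries K)[X]} (h : ∀ n, slice n g = 0) : g = 0 := by
  ext j n
  rw [← coeff_slice, h]
  rfl

theorem exists_slice_eq_zero_of_lt (g : (LaurentSeries K)[X]) :
    ∃ N : ℤ, ∀ n < N, slice n g = 0 := by
  obtain ⟨N, hN⟩ : ∃ N : ℤ, ∀ j ∈ g.support, N ≤ (g.coeff j).order := by
    obtain ⟨N, hN⟩ := (g.support.image fun j => (g.coeff j).order).bddBelow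
    exact ⟨N, fun j hj => hN (by simpa using ⟨j, by simpa using hj, rfl⟩)⟩
  refine ⟨N, fun n hn => ?_⟩
  ext j
  rw [coeff_slice, coeff_zero]
  by_cases hj : j ∈ g.support
  · exact HahnSeries.coeff_eq_zero_of_lt_order (hn.trans_le (hN j hj))
  · rw [notMem_support_iff.1 hj]; rfl

theorem exists_least_slice {g : (LaurentSeries K)[X]} (hg : g ≠ 0) :
    ∃ n : ℤ, slice n g ≠ 0 ∧ ∀ m < n, slice m g = 0 := by
  obtain ⟨N, hN⟩ := exists_slice_eq_zero_of_lt g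
  have hex : ∃ n, slice n g ≠ 0 := by
    by_contra h
    push Not at h
    exact hg (eq_zero_of_slice_eq_zero h)
  obtain ⟨n, hn, hmin⟩ := Int.exists_least_of_bdd (P := fun n => slice n g ≠ 0)
    ⟨N, fun z hz => not_lt.1 fun h => hz (hN z h)⟩ hex
  exact ⟨n, hn, fun m hm => not_not.1 fun h => absurd (hmin m h) (not_le.2 hm)⟩

theorem slice_C_mul_of_lt {u : LaurentSeries K} {g : (LaurentSeries K)[X]} {n m : ℤ}
    (hu : ∀ k < 0, u.coeff k = 0) (hg : ∀ k < n, slice k g = 0) (hm : m < n) :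
    slice m (C u * g) = 0 := by
  ext j
  rw [coeff_slice, coeff_C_mul, coeff_zero]
  refine LaurentSeries.coeff_mul_of_lt hu (b := n) (fun k hk => ?_) (by omega)
  rw [← coeff_slice, hg k hk, coeff_zero]

theorem slice_C_mul {u : LaurentSeries K} {g : (LaurentSeries K)[X]} {n : ℤ}
    (hu : ∀ k < 0, u.coeff k = 0) (hg : ∀ k < n, slice k g = 0) :
    slice n (C u * g) = u.coeff 0 • slice n g := by
  ext j
  rw [coeff_slice, coeff_C_mul, coeff_smul, coeff_slice, smul_eq_mul]
  have h := LaurentSeries.coeff_mul_add hu (b := n) (g := g.coeff j) (fun k hk => by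
    rw [← coeff_slice, hg k hk, coeff_zero])
  rwa [zero_add] at h

/-- The action of `y + d/d(log t)` on polynomials in `log t`. -/
noncomputable def eulerFactor (y : K) : Module.End K K[X] :=
  y • LinearMap.id + derivative

theorem eulerFactor_apply (y : K) (q : K[X]) : eulerFactor y q = y • q + derivative q := rfl

/-- The product of the factors `x - i + d/d(log t)` for `i < r`. -/
noncomputable def eulerProd (x : K) : ℕ → Module.End K K[X]
  | 0 => 1
  | r + 1 => eulerFactor (x - r) * eulerProd x r

theorem slice_twistedDerivLin (c : K) (n : ℤ) (g : (LaurentSeries K)[X]) :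
    slice n (twistedDerivLin c g) = eulerFactor (c + (n + 1 : ℤ)) (slice (n + 1) g) := by
  ext j
  rw [coeff_slice, coeff_twistedDerivLin, eulerFactor_apply, coeff_add, coeff_smul,
    coeff_derivative, coeff_slice, coeff_slice, smul_eq_mul]
  push_cast
  ring

/-- Each `D` contributes one factor: `D (t ^ y q(log t)) = t ^ (y - 1) (y q + q')(log t)`. -/
theorem slice_twistedDerivLin_pow (c : K) (n : ℤ) (r : ℕ) (g : (LaurentSeries K)[X]) :
    slice (n - r) ((twistedDerivLin c ^ r) g) = eulerProd (c + n) r (slice n g) := by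
  induction r with
  | zero => simp [eulerProd]
  | succ r ih =>
    rw [pow_succ', Module.End.mul_apply, slice_twistedDerivLin, eulerProd, Module.End.mul_apply,
      ← ih, show n - ((r + 1 : ℕ) : ℤ) + 1 = n - r by push_cast; ring]
    congr 2
    push_cast
    ring

/-- The leading term of `P g` when the coefficients of `P` have no poles. -/
theorem slice_opAct {c α : K} {P : DiffOp (RatFunc K)} {r : ℕ} (hr : P.order ≤ r)
    (hP : ∀ i, ∀ k < 0, (expandAt α (P.coeff i)).coeff k = 0) {g : (LaurentSeries K)[X]} {n : ℤ}
    (hg : ∀ k < n, slice k g = 0) :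
    slice (n - r) (opAct c α P g) =
      (expandAt α (P.coeff r)).coeff 0 • eulerProd (c + n) r (slice n g) := by
  -- `D ^ i g` starts no earlier than `n - i`, so only `i = r` reaches the exponent `n - r`.
  have hvan : ∀ i : ℕ, ∀ k < n - i, slice k ((twistedDerivLin c ^ i) g) = 0 := fun i k hk => by
    have := slice_twistedDerivLin_pow c (k + i) i g
    rw [add_sub_cancel_right] at this
    rw [this, hg _ (by omega), map_zero]
  rw [opAct_eq_sum c α P (Nat.lt_succ_of_le hr), map_sum, Finset.sum_range_succ,
    slice_C_mul (hP r) (hvan r), slice_twistedDerivLin_pow, Finset.sum_eq_zero, zero_add]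
  intro i hi
  rw [Finset.mem_range] at hi
  exact slice_C_mul_of_lt (hP i) (hvan i) (by omega)

/-- Differentiation lowers the degree, so the leading coefficient is merely multiplied by `y`. -/
theorem eulerFactor_eq_zero {y : K} (hy : y ≠ 0) {q : K[X]} (h : eulerFactor y q = 0) :
    q = 0 := by
  by_contra hq
  have h1 := congrArg (fun p => coeff p q.natDegree) h
  simp only [eulerFactor_apply, coeff_add, coeff_smul, coeff_derivative, coeff_zero,
    coeff_eq_zero_of_natDegree_lt (Nat.lt_succ_self _), zero_mul, add_zero, smul_eq_mul] at h1
  rcases mul_eq_zero.1 h1 with h2 | h2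
  · exact hy h2
  · exact hq (leadingCoeff_eq_zero.1 h2)

theorem eulerProd_eq_zero {x : K} {r : ℕ} (hx : ∀ i < r, x ≠ i) {q : K[X]}
    (h : eulerProd x r q = 0) : q = 0 := by
  induction r with
  | zero => exact h
  | succ r ih =>
    rw [eulerProd, Module.End.mul_apply] at h
    exact ih (fun i hi => hx i (by omega))
      (eulerFactor_eq_zero (sub_ne_zero.2 (hx r (by omega))) h)

theorem derivative_eulerProd (x : K) (r : ℕ) (q : K[X]) :
    derivative (eulerProd x r q) = eulerProd x r (derivative q) := by
  induction r with
  | zero => rfl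
  | succ r ih =>
    rw [eulerProd, Module.End.mul_apply, eulerFactor_apply, derivative_add, derivative_smul, ih,
      Module.End.mul_apply, eulerFactor_apply]

/-- In characteristic zero at most one of the numbers `x - i` vanishes, so at most one factor fails
to be injective, and that factor is `d/d(log t)` itself. Hence the leading term of a solution at an
ordinary point has no logarithm. -/
theorem derivative_eq_zero_of_eulerProd [CharZero K] {x : K} {r : ℕ} {q : K[X]} (h : eulerProd x r q = 0) :
    derivative q = 0 := by
  induction r with
  | zero => rw [show q = 0 from h, derivative_zero]
  | succ r ih =>
    rw [eulerProd, Module.End.mul_apply] at h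
    rcases eq_or_ne (x - r) 0 with hx | hx
    · rw [hx, eulerFactor_apply, zero_smul, zero_add, derivative_eulerProd] at h
      refine eulerProd_eq_zero (fun i hi hxi => ?_) h
      rw [hxi, sub_eq_zero, Nat.cast_inj] at hx
      omega
    · exact ih (eulerFactor_eq_zero hx h)

end Slice

/-! ### Solutions at ordinary points -/

/-- Since `Φ u n` depends only on the values of `u` below `n`, the equation `u = Φ u` is a recursive
definition. -/
theorem Nat.exists_fixedPoint_of_causal {A : Type*} [Nonempty A] (Φ : (ℕ → A) → ℕ → A)
    (hΦ : ∀ u v n, (∀ m < n, u m = v m) → Φ u n = Φ v n) : ∃ u, ∀ n, u n = Φ u n := by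
  let F : ∀ n : ℕ, (∀ m, m < n → A) → A := fun n ih =>
    Φ (fun m => if h : m < n then ih m h else Classical.arbitrary A) n
  refine ⟨wellFounded_lt.fix F, fun n => ?_⟩
  rw [wellFounded_lt.fix_eq F n]
  exact hΦ _ _ n fun m hm => by simp [hm]

section Ordinary

variable {K : Type*} [Field K]

/-- The point `α` is an ordinary point of the operator `P`: the coefficients have no pole at `α`
and the leading coefficient does not vanish at `α`. -/
def IsOrdinary (α : K) (P : DiffOp (RatFunc K)) : Prop :=
  (∀ i, ∀ k < 0, (expandAt α (P.coeff i)).coeff k = 0) ∧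
    (expandAt α (P.coeff P.order)).coeff 0 ≠ 0

theorem slice_C (n : ℤ) (x : LaurentSeries K) : slice n (C x) = C (x.coeff n) := by
  ext j
  rw [coeff_slice, coeff_C, coeff_C]
  split_ifs <;> rfl

theorem twistedDerivLin_zero_pow_C (i : ℕ) (x : LaurentSeries K) :
    (twistedDerivLin 0 ^ i) (C x) = C ((LaurentSeries.derivative K)^[i] x) := by
  induction i with
  | zero => rfl
  | succ i ih =>
    rw [pow_succ', Module.End.mul_apply, ih, Function.iterate_succ_apply']
    have h := twistedDerivLin_C_mul (0 : K) ((LaurentSeries.derivative K)^[i] x) 1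
    have h1 : twistedDerivLin (0 : K) 1 = 0 := by
      ext j n
      rw [coeff_twistedDerivLin, coeff_one, coeff_one, if_neg (Nat.succ_ne_zero j)]
      split_ifs with hj
      · rw [HahnSeries.coeff_one]
        split_ifs with hn
        · have : (n : K) + 1 = 0 := by exact_mod_cast congrArg (Int.cast : ℤ → K) hn
          simp [this]
        · simp
      · simp
    simpa [h1] using h

/-- The action of an operator on a Laurent series. -/
noncomputable def laurentAct (α : K) (P : DiffOp (RatFunc K)) (x : LaurentSeries K) :
    LaurentSeries K :=
  ∑ i ∈ Finset.range (P.order + 1), expandAt α (P.coeff i) * (LaurentSeries.derivative K)^[i] x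

theorem opAct_zero_C (α : K) (P : DiffOp (RatFunc K)) (x : LaurentSeries K) :
    opAct 0 α P (C x) = C (laurentAct α P x) := by
  rw [opAct_eq_sum 0 α P (Nat.lt_succ_self _), laurentAct, map_sum]
  simp only [twistedDerivLin_zero_pow_C, C_mul]

theorem iterate_derivative_ofPowerSeries (i : ℕ) (u : PowerSeries K) :
    (LaurentSeries.derivative K)^[i] (HahnSeries.ofPowerSeries ℤ K u) =
      HahnSeries.ofPowerSeries ℤ K ((PowerSeries.derivative K)^[i] u) := by
  induction i with
  | zero => rfl
  | succ i ih =>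
    rw [Function.iterate_succ_apply', ih, LaurentSeries.derivative_ofPowerSeries,
      Function.iterate_succ_apply']

theorem coeff_ofPowerSeries_of_neg (u : PowerSeries K) {n : ℤ} (hn : n < 0) :
    (HahnSeries.ofPowerSeries ℤ K u).coeff n = 0 := by
  rw [HahnSeries.ofPowerSeries_apply, HahnSeries.embDomain_of_notMem_range (by simp; omega)]

/-- At the lowest exponent `m` present in the coefficients of `P`, only the constant terms of the
derivatives of `u` contribute. -/
theorem coeff_laurentAct_ofPowerSeries (α : K) (P : DiffOp (RatFunc K)) (u : PowerSeries K)
    {m : ℤ} (hP : ∀ i, ∀ k < m, (expandAt α (P.coeff i)).coeff k = 0) :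
    (laurentAct α P (HahnSeries.ofPowerSeries ℤ K u)).coeff m =
      ∑ i ∈ Finset.range (P.order + 1),
        (expandAt α (P.coeff i)).coeff m * ((i.factorial : K) * PowerSeries.coeff i u) := by
  rw [laurentAct, HahnSeries.coeff_sum]
  refine Finset.sum_congr rfl fun i _ => ?_
  rw [iterate_derivative_ofPowerSeries]
  have h := LaurentSeries.coeff_mul_add (hP i) (b := 0)
    (fun k hk => coeff_ofPowerSeries_of_neg ((PowerSeries.derivative K)^[i] u) hk)
  rw [add_zero] at h
  rw [h]
  congr 1
  have h2 := LaurentSeries.coeff_coe_powerSeries ((PowerSeries.derivative K)^[i] u) 0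
  rw [Nat.cast_zero] at h2
  rw [h2, PowerSeries.coeff_iterate_derivative]
  simp

theorem coeff_laurentAct_ofPowerSeries_of_lt (α : K) (P : DiffOp (RatFunc K)) (u : PowerSeries K)
    {m k : ℤ} (hP : ∀ i, ∀ k < m, (expandAt α (P.coeff i)).coeff k = 0) (hk : k < m) :
    (laurentAct α P (HahnSeries.ofPowerSeries ℤ K u)).coeff k = 0 := by
  rw [coeff_laurentAct_ofPowerSeries α P u fun i l hl => hP i l (hl.trans hk)]
  exact Finset.sum_eq_zero fun i _ => by rw [hP i k hk, zero_mul]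

theorem laurentAct_sub (α : K) (P : DiffOp (RatFunc K)) (x y : LaurentSeries K) :
    laurentAct α P (x - y) = laurentAct α P x - laurentAct α P y := by
  apply C_injective
  rw [C_sub, ← opAct_zero_C, ← opAct_zero_C, ← opAct_zero_C, C_sub, map_sub]

/-- The leading term of a solution at an ordinary point. -/
theorem leading_slice_of_solution {α : K} {P : DiffOp (RatFunc K)} (hP : IsOrdinary α P) {c : K}
    {g : (LaurentSeries K)[X]} (hg : opAct c α P g = 0) {n : ℤ} (hn : ∀ m < n, slice m g = 0) :
    eulerProd (c + n) P.order (slice n g) = 0 := by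
  have h := slice_opAct (c := c) le_rfl hP.1 hn
  rw [hg, map_zero, eq_comm, smul_eq_zero] at h
  exact h.resolve_left hP.2

variable [CharZero K]

theorem eulerProd_one {x : K} {r : ℕ} (hx : ∀ i < r, x ≠ i) :
    ∃ e : K, e ≠ 0 ∧ ∀ a : K, eulerProd x r (C a) = C (e * a) := by
  have h1 : derivative (eulerProd x r 1) = 0 := by
    rw [derivative_eulerProd, derivative_one, map_zero]
  have h2 := derivative_eq_zero.1 h1
  rw [natDegree_eq_zero] at h2
  obtain ⟨e, he⟩ := h2
  refine ⟨e, fun h0 => ?_, fun a => ?_⟩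
  · rw [h0, C_0] at he
    exact one_ne_zero (eulerProd_eq_zero hx he.symm)
  · have : (C a : K[X]) = a • 1 := by rw [smul_eq_C_mul, mul_one]
    rw [this, map_smul, ← he, smul_eq_C_mul, ← C_mul, mul_comm]

/-- At an ordinary point, there are power series solutions with arbitrary initial values. -/
theorem exists_powerSeries_solution {α : K} {P : DiffOp (RatFunc K)} (hP : IsOrdinary α P)
    (k : ℕ) : ∃ u : PowerSeries K, opAct 0 α P (C (HahnSeries.ofPowerSeries ℤ K u)) = 0 ∧
      ∀ n < P.order, PowerSeries.coeff n u = if n = k then 1 else 0 := by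
  obtain ⟨hP, h0⟩ := hP
  set r := P.order with hr
  -- For `r ≤ n` the scalar `e n` is `n (n - 1) ⋯ (n - r + 1)`, by which `D ^ r` acts on `t ^ n`;
  -- below `r` its value is irrelevant.
  have he : ∀ n : ℕ, ∃ e : K, r ≤ n → e ≠ 0 ∧ ∀ a : K, eulerProd (n : K) r (C a) = C (e * a) := by
    intro n
    by_cases hn : r ≤ n
    · obtain ⟨e, he⟩ := eulerProd_one (x := (n : K)) (r := r) fun i hi h => by
        rw [Nat.cast_inj] at h; omega
      exact ⟨e, fun _ => he⟩
    · exact ⟨0, fun h => absurd h hn⟩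
  choose e he using he
  set a0 := (expandAt α (P.coeff r)).coeff 0 with ha0
  let W : (ℕ → K) → ℤ → K := fun u n =>
    (laurentAct α P (HahnSeries.ofPowerSeries ℤ K (PowerSeries.mk u))).coeff n
  -- The coefficient `n - r` of `P u` is affine in `u n` with slope `a0 * e n`. So the corrected
  -- value does not depend on `u n`, and a fixed point is a sequence for which this coefficient
  -- vanishes.
  let Φ : (ℕ → K) → ℕ → K := fun u n =>
    if n < r then (if n = k then 1 else 0) else u n - W u (n - r) / (a0 * e n)
  obtain ⟨u, hu⟩ := Nat.exists_fixedPoint_of_causal Φ fun u v n huv => by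
    by_cases hn : n < r
    · simp only [Φ, if_pos hn]
    · simp only [Φ, if_neg hn]
      obtain ⟨hen, hen'⟩ := he n (not_lt.1 hn)
      -- The difference starts at `t ^ n`, so the leading term formula computes `W u - W v`.
      set w := PowerSeries.mk u - PowerSeries.mk v
      have hw : ∀ m < (n : ℤ), slice m (C (HahnSeries.ofPowerSeries ℤ K w)) = 0 := fun m hm => by
        rw [slice_C]
        rcases lt_or_ge m 0 with h | h
        · rw [coeff_ofPowerSeries_of_neg _ h, C_0]
        · lift m to ℕ using h
          rw [LaurentSeries.coeff_coe_powerSeries]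
          simp [w, huv m (by omega)]
      have h1 := slice_opAct (c := 0) le_rfl hP hw
      rw [opAct_zero_C, slice_C, slice_C, zero_add, LaurentSeries.coeff_coe_powerSeries] at h1
      rw [← hr, Int.cast_natCast, hen', ← ha0, smul_C, C_inj, map_sub (HahnSeries.ofPowerSeries ℤ K),
        laurentAct_sub] at h1
      rw [map_sub (PowerSeries.coeff n), PowerSeries.coeff_mk, PowerSeries.coeff_mk,
        HahnSeries.coeff_sub, smul_eq_mul] at h1
      have h2 : W u (n - r) - W v (n - r) = a0 * (e n * (u n - v n)) := h1
      have h3 : W u (n - r) = W v (n - r) + a0 * (e n * (u n - v n)) := by rw [← h2]; ring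
      rw [h3]
      field_simp
      ring
  refine ⟨PowerSeries.mk u, ?_, fun n hn => ?_⟩
  · rw [opAct_zero_C, C_eq_zero]
    ext m
    rcases lt_or_ge m 0 with h | h
    · exact coeff_laurentAct_ofPowerSeries_of_lt α P _ hP h
    · lift m to ℕ using h
      obtain ⟨hen, -⟩ := he (m + r) (by omega)
      have h := hu (m + r)
      simp only [Φ, if_neg (show ¬ m + r < r by omega)] at h
      rw [eq_comm, sub_eq_self, div_eq_zero_iff] at h
      have h := h.resolve_right (mul_ne_zero h0 hen)
      simpa [W] using h
  · rw [PowerSeries.coeff_mk, hu n]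
    simp only [Φ, if_pos hn]

/-- At an ordinary point of `L`, an operator of smaller order which maps all power series solutions
of `L` to power series has no poles. -/
theorem coeff_expandAt_eq_zero_of_laurentAct {α : K} {L P : DiffOp (RatFunc K)}
    (hL : IsOrdinary α L) (hord : P.order < L.order)
    (hP : ∀ u : PowerSeries K, opAct 0 α L (C (HahnSeries.ofPowerSeries ℤ K u)) = 0 →
      ∀ k < 0, (laurentAct α P (HahnSeries.ofPowerSeries ℤ K u)).coeff k = 0) (i : ℕ) :
    ∀ k < 0, (expandAt α (P.coeff i)).coeff k = 0 := by
  by_contra! hcon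
  obtain ⟨k, hk, hik⟩ := hcon
  have hcoeff : ∀ i, P.order < i → P.coeff i = 0 := fun i hi =>
    coeff_eq_zero_of_natDegree_lt (p := P.symbol) hi
  obtain ⟨N, hN⟩ : ∃ N : ℤ, ∀ j ∈ Finset.range (P.order + 1),
      N ≤ (expandAt α (P.coeff j)).order := by
    obtain ⟨N, hN⟩ :=
      ((Finset.range (P.order + 1)).image fun j => (expandAt α (P.coeff j)).order).bddBelow
    exact ⟨N, fun j hj => hN (by simpa using ⟨j, by simpa using hj, rfl⟩)⟩
  have hle : ∀ j, (∃ n, (expandAt α (P.coeff j)).coeff n ≠ 0) → j ≤ P.order := fun j ⟨n, hn⟩ => by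
    by_contra h
    rw [hcoeff j (not_le.1 h), map_zero] at hn
    exact hn rfl
  -- Here `-m` is the highest pole order among the coefficients of `P`, attained at `j`.
  obtain ⟨m, ⟨j, hj⟩, hmin⟩ := Int.exists_least_of_bdd
    (P := fun n => ∃ j, (expandAt α (P.coeff j)).coeff n ≠ 0)
    ⟨N, fun z ⟨j, hz⟩ => (hN j (by rw [Finset.mem_range]; exact Nat.lt_succ_of_le (hle j ⟨z, hz⟩))).trans
      (HahnSeries.order_le_of_coeff_ne_zero hz)⟩ ⟨k, i, hik⟩
  have hlow : ∀ i, ∀ k < m, (expandAt α (P.coeff i)).coeff k = 0 := fun i k hk => by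
    by_contra h
    exact absurd (hmin k ⟨i, h⟩) (not_le.2 hk)
  have hjP := hle j ⟨m, hj⟩
  -- The solution `t ^ j + O(t ^ r)` isolates the coefficient of `D ^ j` at the exponent `m`.
  obtain ⟨u, hu, hinit⟩ := exists_powerSeries_solution hL j
  have h := hP u hu m ((hmin k ⟨i, hik⟩).trans_lt hk)
  rw [coeff_laurentAct_ofPowerSeries α P u hlow, Finset.sum_eq_single j] at h
  · rw [hinit j (by omega), if_pos rfl, mul_one] at h
    exact (mul_ne_zero hj (Nat.cast_ne_zero.2 (Nat.factorial_ne_zero j))) h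
  · intro b hb hbj
    rw [Finset.mem_range] at hb
    rw [hinit b (by omega), if_neg hbj, mul_zero, mul_zero]
  · intro h
    exact absurd (Finset.mem_range.2 (Nat.lt_succ_of_le hjP)) h

/-- The leading term has no logarithm, so subtracting a multiple of the power series solution
starting with `t ^ i` raises the starting exponent from `i` to `i + 1`; `j` counts the remaining
steps. At `i = r` no admissible leading exponent is left, so the rest is zero. -/
theorem exists_eq_C_of_solution {α : K} {P : DiffOp (RatFunc K)} (hP : IsOrdinary α P) {m : ℤ}
    (j : ℕ) : ∀ i : ℕ, i + j = P.order → ∀ g : (LaurentSeries K)[X],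
      opAct (-m : K) α P g = 0 → (∀ n < m + i, slice n g = 0) → ∃ x, g = C x := by
  induction j with
  | zero =>
    intro i hi g hg hlow
    by_cases h : g = 0
    · exact ⟨0, by rw [h, C_0]⟩
    · exfalso
      obtain ⟨n, hn, hn'⟩ := exists_least_slice h
      refine hn (eulerProd_eq_zero (fun k hk hkn => ?_) (leading_slice_of_solution hP hg hn'))
      have : (-m + n : ℤ) = k := by exact_mod_cast hkn
      exact hn (hlow n (by omega))
  | succ j ih =>
    intro i hi g hg hlow
    have hlead := derivative_eq_zero_of_eulerProd (leading_slice_of_solution hP hg hlow)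
    obtain ⟨a, ha⟩ := natDegree_eq_zero.1 (derivative_eq_zero.1 hlead)
    obtain ⟨u, hu, hinit⟩ := exists_powerSeries_solution hP i
    set y : LaurentSeries K := HahnSeries.single m a * HahnSeries.ofPowerSeries ℤ K u
    have hy : opAct (-m : K) α P (C y) = 0 := by
      rw [C_mul, opAct_single_mul, neg_add_cancel, hu, mul_zero]
    obtain ⟨x, hx⟩ := ih (i + 1) (by omega) (g - C y)
      (by rw [map_sub, hg, hy, sub_zero]) (fun n hn => by
        rw [map_sub, slice_C, HahnSeries.coeff_single_mul]
        rcases lt_or_ge (n - m) 0 with h | h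
        · rw [hlow n (by omega), coeff_ofPowerSeries_of_neg _ h, mul_zero, C_0, sub_zero]
        · obtain ⟨l, hl⟩ := Int.eq_ofNat_of_zero_le h
          rw [hl, LaurentSeries.coeff_coe_powerSeries, hinit l (by push_cast at hn; omega)]
          split_ifs with hli
          · rw [show n = m + i by omega, ← ha, mul_one, sub_self]
          · rw [hlow n (by push_cast at hn; omega), mul_zero, C_0, sub_zero])
    refine ⟨x + y, ?_⟩
    rw [C_add, ← hx, sub_add_cancel]

/-- At an ordinary point, all solutions are power series up to a shift of the exponent; without
logarithms. -/
theorem solution_of_ordinary {α : K} {P : DiffOp (RatFunc K)} (hP : IsOrdinary α P) {c : K}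
    {g : (LaurentSeries K)[X]} (hg : opAct c α P g = 0) (hg0 : g ≠ 0) :
    ∃ m : ℤ, c = m ∧ (∀ n < -m, slice n g = 0) ∧ ∃ x, g = C x := by
  obtain ⟨n, hn, hlow⟩ := exists_least_slice hg0
  have hlead := leading_slice_of_solution hP hg hlow
  -- The leading exponent is a root of the indicial polynomial `y (y - 1) ⋯ (y - r + 1)`.
  obtain ⟨k, hk, hck⟩ : ∃ k < P.order, c + n = (k : K) := by
    by_contra! h
    exact hn (eulerProd_eq_zero h hlead)
  obtain rfl : c = (-(n - k : ℤ) : K) := by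
    push_cast
    rw [← hck]
    ring
  refine ⟨-(n - k), by push_cast; ring, fun l hl => hlow l (by omega), ?_⟩
  exact exists_eq_C_of_solution hP P.order 0 (zero_add _) g hg fun l hl => hlow l (by omega)

end Ordinary

/-! ### Integrality at a point -/

theorem GenSeries.coeff_exponent_add {C K : Type*} [Field C] [CharZero C] [Field K]
    (f : GenSeries C K) (n : ℤ) (j : ℕ) :
    f.coeff (f.exponent + n) j = (f.body.coeff j).coeff n := by
  have hinj : Function.Injective fun n : ℤ => f.exponent + (n : C) := fun a b h => by
    simpa using h
  exact congrFun (hinj.extend_apply _ _ n) j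

theorem GenSeries.coeff_eq_zero {C K : Type*} [Field C] [Field K]
    (f : GenSeries C K) {μ : C} (hμ : ∀ n : ℤ, f.exponent + n ≠ μ) (j : ℕ) : f.coeff μ j = 0 := by
  rw [GenSeries.coeff, Function.extend_apply' _ _ _ fun ⟨n, hn⟩ => hμ n hn]
  rfl

theorem Threshold.exists_eq_add {C : Type*} [Field C] (ι : Threshold C) (ν : C) (j : ℕ) :
    ∃ z : ℤ, ι.toFun (QuotientAddGroup.mk ν) j = ν + z := by
  have h := ι.mk_toFun (QuotientAddGroup.mk ν) j
  rw [eq_comm, QuotientAddGroup.eq, AddSubgroup.mem_zmultiples_iff] at h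
  obtain ⟨z, hz⟩ := h
  refine ⟨z, ?_⟩
  rw [zsmul_one] at hz
  rw [hz]
  ring

/-- The least integer `n` for which the term `t ^ (ν + n) (log t) ^ j` is integral. -/
noncomputable def Threshold.bound {C : Type*} [Field C] (ι : Threshold C) (ν : C) (j : ℕ) : ℤ :=
  (ι.exists_eq_add ν j).choose

theorem Threshold.toFun_mk {C : Type*} [Field C] (ι : Threshold C) (ν : C) (j : ℕ) :
    ι.toFun (QuotientAddGroup.mk ν) j = ν + ι.bound ν j :=
  (ι.exists_eq_add ν j).choose_spec

/-- The normalisation `ι(ℤ, 0) = 0` enters here: for integer exponents and no logarithm, integral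
means without pole. -/
theorem Threshold.bound_intCast {C : Type*} [Field C] [CharZero C] (ι : Threshold C) (m : ℤ) :
    ι.bound (m : C) 0 = -m := by
  have h := ι.toFun_mk (m : C) 0
  have h0 : (QuotientAddGroup.mk (m : C) : C ⧸ AddSubgroup.zmultiples (1 : C)) = 0 := by
    rw [QuotientAddGroup.eq_zero_iff, AddSubgroup.mem_zmultiples_iff]
    exact ⟨m, by simp⟩
  rw [h0, ι.map_zero] at h
  have : (m + ι.bound (m : C) 0 : ℤ) = 0 := by exact_mod_cast h.symm
  omega

theorem GenSeries.isIntegral_iff {C K : Type*} [Field C] [CharZero C] [Field K] (ι : Threshold C)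
    (f : GenSeries C K) : f.IsIntegral ι ↔
      ∀ n j, n < ι.bound f.exponent j → (f.body.coeff j).coeff n = 0 := by
  have hmk : ∀ n : ℤ, (QuotientAddGroup.mk (f.exponent + n) : C ⧸ AddSubgroup.zmultiples (1 : C)) =
      QuotientAddGroup.mk f.exponent := fun n => by
    rw [eq_comm, QuotientAddGroup.eq, AddSubgroup.mem_zmultiples_iff]
    exact ⟨n, by simp⟩
  constructor
  · intro h n j hn
    by_contra hne
    rw [← f.coeff_exponent_add] at hne
    obtain ⟨k, hk⟩ := h _ _ hne
    rw [hmk, ι.toFun_mk] at hk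
    have : (n - ι.bound f.exponent j : ℤ) = k := by
      have : ((n - ι.bound f.exponent j : ℤ) : C) = (k : ℤ) := by
        push_cast
        rw [← hk]
        ring
      exact_mod_cast this
    omega
  · intro h μ j hne
    by_cases hμ : ∃ n : ℤ, f.exponent + n = μ
    · obtain ⟨n, rfl⟩ := hμ
      rw [f.coeff_exponent_add] at hne
      have hn : ι.bound f.exponent j ≤ n := not_lt.1 fun hlt => hne (h n j hlt)
      obtain ⟨k, hk⟩ := Int.eq_ofNat_of_zero_le (sub_nonneg.2 hn)
      refine ⟨k, ?_⟩
      rw [hmk, ι.toFun_mk]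
      have : ((n - ι.bound f.exponent j : ℤ) : C) = (k : ℤ) := by rw [hk]
      push_cast at this
      rw [← this]
      ring
    · push Not at hμ
      exact absurd (f.coeff_eq_zero hμ j) hne

section IntegralAt

variable {C K : Type*} [Field C] [Field K] [Algebra C K]

/-- The operator `P` maps the series solutions of `L` at `α` to integral series. -/
def IntegralAt (ι : Threshold C) (L : DiffOp (RatFunc K)) (α : K) (P : DiffOp (RatFunc K)) : Prop :=
  ∀ (ν : C) (g : (LaurentSeries K)[X]), opAct (algebraMap C K ν) α L g = 0 →
    ∀ n j, n < ι.bound ν j → ((opAct (algebraMap C K ν) α P g).coeff j).coeff n = 0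

theorem integralAt_iff [CharZero C] (ι : Threshold C) (L : DiffOp (RatFunc K)) (α : K)
    (P : DiffOp (RatFunc K)) : IntegralAt ι L α P ↔
      ∀ f : GenSeries C K, f.IsSolution α L → (f.act α P).IsIntegral ι := by
  constructor
  · intro h f hf
    rw [GenSeries.isIntegral_iff, GenSeries.act_body]
    rw [GenSeries.IsSolution, GenSeries.act_body] at hf
    exact h _ _ hf
  · intro h ν g hg
    have h1 := h ⟨ν, g⟩ (by rw [GenSeries.IsSolution, GenSeries.act_body]; exact hg)
    rw [GenSeries.isIntegral_iff, GenSeries.act_body] at h1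
    exact h1

variable {ι : Threshold C} {L : DiffOp (RatFunc K)} {α : K}

theorem IntegralAt.zero : IntegralAt ι L α 0 := fun ν g _ n j _ => by
  rw [opAct_zero]; rfl

theorem IntegralAt.add {P Q : DiffOp (RatFunc K)} (hP : IntegralAt ι L α P)
    (hQ : IntegralAt ι L α Q) : IntegralAt ι L α (P + Q) := fun ν g hg n j hn => by
  rw [opAct_add, LinearMap.add_apply, coeff_add, HahnSeries.coeff_add, hP ν g hg n j hn,
    hQ ν g hg n j hn, add_zero]

theorem IntegralAt.smul {P : DiffOp (RatFunc K)} (hP : IntegralAt ι L α P) {a : RatFunc K}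
    (ha : ∀ k < 0, (expandAt α a).coeff k = 0) : IntegralAt ι L α (a • P) := fun ν g hg n j hn => by
  rw [opAct_smul, Module.End.mul_apply, mulSeries_apply, coeff_C_mul]
  exact LaurentSeries.coeff_mul_of_lt ha (fun k hk => hP ν g hg k j hk) (by omega)

theorem IntegralAt.sub {P Q : DiffOp (RatFunc K)} (hP : IntegralAt ι L α P)
    (hQ : IntegralAt ι L α Q) : IntegralAt ι L α (P - Q) := by
  have h := hP.add (hQ.smul (a := -1) fun k hk => by
    rw [map_neg, map_one, HahnSeries.coeff_neg, HahnSeries.coeff_one, if_neg hk.ne, neg_zero])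
  rwa [neg_one_smul, ← sub_eq_add_neg] at h

theorem IntegralAt.sum {κ : Type*} {s : Finset κ} {P : κ → DiffOp (RatFunc K)}
    (h : ∀ i ∈ s, IntegralAt ι L α (P i)) : IntegralAt ι L α (∑ i ∈ s, P i) := by
  classical
  induction s using Finset.induction_on with
  | empty => exact .zero
  | insert i s hi ih =>
    rw [Finset.sum_insert hi]
    exact (h i (Finset.mem_insert_self i s)).add
      (ih fun j hj => h j (Finset.mem_insert_of_mem hj))

theorem IntegralAt.of_mul (R : DiffOp (RatFunc K)) : IntegralAt ι L α (R * L) :=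
  fun ν g hg n j _ => by
    rw [opAct_mul, Module.End.mul_apply, hg, map_zero]; rfl

/-- The logarithmic derivation of a solution is a solution, so that the derivative of an integral
element has at most one additional pole. -/
theorem IntegralAt.smul_D_mul [CharZero C] {P : DiffOp (RatFunc K)} (hP : IntegralAt ι L α P)
    {s : RatFunc K} (hs : ∀ k < 1, (expandAt α s).coeff k = 0) :
    IntegralAt ι L α (s • (DiffOp.D * P)) := fun ν g hg n j hn => by
  have : CharZero K := charZero_of_injective_algebraMap (algebraMap C K).injective
  rw [opAct_smul, Module.End.mul_apply, mulSeries_apply, coeff_C_mul, opAct_mul,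
    Module.End.mul_apply, opAct_D]
  refine LaurentSeries.coeff_mul_of_lt hs (b := ι.bound ν j - 1) (fun k hk => ?_) (by omega)
  -- The term with `(log t) ^ (j + 1)` must meet the threshold for `j`, which may exceed the one for
  -- `j + 1`. The bound comes from integrality on the solution `dg/d(log t)`.
  have h := hP ν (derivative g) (by rw [← derivative_opAct, hg, derivative_zero]) (k + 1) j
    (by omega)
  rw [← derivative_opAct, coeff_derivative, mul_comm] at h
  have h1 : ((j : LaurentSeries K) + 1) = HahnSeries.single 0 ((j : K) + 1) := by
    rw [HahnSeries.single_add, HahnSeries.single_zero_natCast]; rfl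
  rw [h1, HahnSeries.coeff_single_zero_mul] at h
  rw [coeff_twistedDerivLin, hP ν g hg (k + 1) j (by omega), h, mul_zero, add_zero]

variable [CharZero C]

theorem exponent_of_ordinary (hL : IsOrdinary α L) {ν : C} {g : (LaurentSeries K)[X]}
    (hg : opAct (algebraMap C K ν) α L g = 0) (hg0 : g ≠ 0) :
    ∃ m : ℤ, ν = m ∧ ∃ x : LaurentSeries K, g = Polynomial.C x ∧ ∀ n < -m, x.coeff n = 0 := by
  have : CharZero K := charZero_of_injective_algebraMap (algebraMap C K).injective
  obtain ⟨m, hm, hlow, x, hx⟩ := solution_of_ordinary hL hg hg0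
  refine ⟨m, (algebraMap C K).injective (by rw [hm, map_intCast]), x, hx, fun n hn => ?_⟩
  have h := hlow n hn
  rwa [hx, slice_C, C_eq_zero] at h

theorem IntegralAt.one_of_ordinary (hL : IsOrdinary α L) : IntegralAt ι L α 1 :=
  fun ν g hg n j hn => by
  have h1 : opAct (algebraMap C K ν) α (1 : DiffOp (RatFunc K)) = 1 := by
    have h := opAct_monomial (algebraMap C K ν) α 0 1
    rw [monomial_zero_one] at h
    refine h.trans ?_
    apply LinearMap.ext; intro q; simp [mulSeries_apply]
  rw [h1, Module.End.one_apply]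
  by_cases hg0 : g = 0
  · rw [hg0]; rfl
  · obtain ⟨m, rfl, x, rfl, hlow⟩ := exponent_of_ordinary hL hg hg0
    rw [coeff_C]
    split_ifs with hj
    · subst hj
      rw [ι.bound_intCast] at hn
      exact hlow n hn
    · rfl

/-- At an ordinary point `P g` is free of logarithms, has integer exponents and no pole;
differentiating such a series creates no pole. -/
theorem IntegralAt.D_mul_of_ordinary (hL : IsOrdinary α L) {P : DiffOp (RatFunc K)}
    (hP : IntegralAt ι L α P) : IntegralAt ι L α (DiffOp.D * P) := fun ν g hg n j hn => by
  rw [opAct_mul, Module.End.mul_apply, opAct_D]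
  by_cases hg0 : g = 0
  · rw [hg0, map_zero, map_zero]; rfl
  · have h0 : derivative (opAct (algebraMap C K ν) α P g) = 0 := by
      obtain ⟨m, rfl, x, rfl, hlow⟩ := exponent_of_ordinary hL hg hg0
      rw [derivative_opAct, derivative_C, map_zero]
    have hint := hP ν g hg
    obtain ⟨m, rfl, -⟩ := exponent_of_ordinary hL hg hg0
    set h := opAct (algebraMap C K (m : C)) α P g
    have h1 : ∀ i, (h.coeff (i + 1)) = 0 := fun i => by
      have : CharZero K := charZero_of_injective_algebraMap (algebraMap C K).injective
      have h2 : (derivative h).coeff i = 0 := by rw [h0, coeff_zero]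
      rw [coeff_derivative] at h2
      refine (mul_eq_zero.1 h2).resolve_right fun h3 => ?_
      have h4 : ((i : LaurentSeries K) + 1) = HahnSeries.single 0 ((i : K) + 1) := by
        rw [HahnSeries.single_add, HahnSeries.single_zero_natCast]; rfl
      rw [h4, HahnSeries.single_eq_zero_iff] at h3
      exact Nat.cast_add_one_ne_zero i h3
    rw [coeff_twistedDerivLin, h1, HahnSeries.coeff_zero, mul_zero, add_zero]
    cases j with
    | zero =>
      rw [ι.bound_intCast] at hn
      -- The index `-m` is the constant term, which `D` kills.
      rcases eq_or_ne (n + 1) (-m) with hnm | hnm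
      · have : ((n : K) + 1 + algebraMap C K m) = ((n + 1 + m : ℤ) : K) := by simp
        rw [this, hnm, neg_add_cancel, Int.cast_zero, zero_mul]
      · rw [hint (n + 1) 0 (by rw [ι.bound_intCast]; omega), mul_zero]
    | succ j => rw [h1, HahnSeries.coeff_zero, mul_zero]

/-- Power series solutions alone detect every pole of the coefficients, and on them integrality of
the image excludes poles. -/
theorem IntegralAt.coeff_expandAt_eq_zero (hL : IsOrdinary α L) {P : DiffOp (RatFunc K)}
    (hord : P.order < L.order) (hP : IntegralAt ι L α P) (i : ℕ) :
    ∀ k < 0, (expandAt α (P.coeff i)).coeff k = 0 := by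
  have : CharZero K := charZero_of_injective_algebraMap (algebraMap C K).injective
  refine coeff_expandAt_eq_zero_of_laurentAct hL hord (fun u hu k hk => ?_) i
  have h0 : algebraMap C K ((0 : ℤ) : C) = 0 := by simp
  have h := hP ((0 : ℤ) : C) (Polynomial.C (HahnSeries.ofPowerSeries ℤ K u))
    (by rw [h0]; exact hu) k 0 (by rw [ι.bound_intCast]; simpa using hk)
  rwa [h0, opAct_zero_C, coeff_C_zero] at h

end IntegralAt

/-! ### Orders of operators -/

namespace DiffOp

theorem symbol_D_mul {F : Type*} [CommRing F] [Differential F] (P : DiffOp F) :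
    (D * P).symbol = leftD P.symbol := by
  change leftMul X P.symbol = _
  rw [← monomial_one_one_eq_X, leftMul_monomial, pow_one, Module.End.mul_apply,
    LinearMap.mulLeft_apply, map_one, one_mul]

section Order

variable {F : Type*} [Field F]

theorem coeff_add (P Q : DiffOp F) (n : ℕ) : (P + Q).coeff n = P.coeff n + Q.coeff n :=
  Polynomial.coeff_add P Q n

theorem coeff_sub (P Q : DiffOp F) (n : ℕ) : (P - Q).coeff n = P.coeff n - Q.coeff n :=
  Polynomial.coeff_sub P Q n

theorem coeff_smul (a : F) (P : DiffOp F) (n : ℕ) : (a • P).coeff n = a * P.coeff n :=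
  Polynomial.coeff_smul a P n

theorem coeff_sum {κ : Type*} (s : Finset κ) (P : κ → DiffOp F) (n : ℕ) :
    (∑ i ∈ s, P i).coeff n = ∑ i ∈ s, (P i).coeff n :=
  Polynomial.finsetSum_coeff s P n

theorem order_le_iff {P : DiffOp F} {n : ℕ} : P.order ≤ n ↔ ∀ m, n < m → P.coeff m = 0 :=
  natDegree_le_iff_coeff_eq_zero

theorem coeff_eq_zero_of_order_lt {P : DiffOp F} {n : ℕ} (h : P.order < n) : P.coeff n = 0 :=
  coeff_eq_zero_of_natDegree_lt (p := P.symbol) h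

theorem coeff_order_ne_zero {P : DiffOp F} (h : P ≠ 0) : P.coeff P.order ≠ 0 :=
  leadingCoeff_ne_zero.2 (show P.symbol ≠ 0 from h)

theorem order_add_le {P Q : DiffOp F} {n : ℕ} (hP : P.order ≤ n) (hQ : Q.order ≤ n) :
    (P + Q).order ≤ n :=
  natDegree_add_le_of_degree_le hP hQ

theorem order_smul_le (a : F) {P : DiffOp F} {n : ℕ} (hP : P.order ≤ n) : (a • P).order ≤ n :=
  (natDegree_smul_le a P.symbol).trans hP

theorem order_sub_le {P Q : DiffOp F} {n : ℕ} (hP : P.order ≤ n) (hQ : Q.order ≤ n) :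
    (P - Q).order ≤ n :=
  (natDegree_sub_le_of_le hP hQ).trans (max_self n).le

theorem order_sum_le {κ : Type*} {s : Finset κ} {P : κ → DiffOp F} {n : ℕ}
    (h : ∀ i ∈ s, (P i).order ≤ n) : (∑ i ∈ s, P i).order ≤ n :=
  natDegree_sum_le_of_forall_le s P h

theorem order_lt_of_coeff_eq_zero {P : DiffOp F} {n : ℕ} (hn : 0 < n) (hP : P.order ≤ n)
    (h : P.coeff n = 0) : P.order < n := by
  refine lt_of_le_of_ne hP fun he => ?_
  by_cases h0 : P = 0
  · rw [h0] at he
    exact hn.ne he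
  · exact coeff_order_ne_zero h0 (he ▸ h)

variable [Differential F]

theorem coeff_D_mul_succ {P : DiffOp F} {n : ℕ} (hP : P.order ≤ n) :
    (D * P).coeff (n + 1) = P.coeff n := by
  have h2 : P.symbol.coeff (n + 1) = 0 := coeff_eq_zero_of_natDegree_lt (Nat.lt_succ_of_le hP)
  rw [coeff, symbol_D_mul, leftD_apply, Polynomial.coeff_add, coeff_X_mul, Differential.coeff_mapCoeffs, h2,
    map_zero, zero_add]
  rfl

theorem order_D_mul_le {P : DiffOp F} {n : ℕ} (hP : P.order ≤ n) : (D * P).order ≤ n + 1 := by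
  rw [order_le_iff]
  intro m hm
  obtain ⟨m, rfl⟩ : ∃ k, m = k + 1 := ⟨m - 1, by omega⟩
  rw [coeff_D_mul_succ (by omega)]
  exact coeff_eq_zero_of_order_lt (by omega)

theorem mul_eq_sum (P Q : DiffOp F) :
    P * Q = ∑ i ∈ Finset.range (P.order + 1), P.coeff i • ((D : DiffOp F) ^ i * Q) := by
  have h1 : ∀ i, leftD ^ i = leftMul (symbol ((D : DiffOp F) ^ i)) := fun i => by
    induction i with
    | zero => exact leftMul_one.symm
    | succ i ih =>
      rw [pow_succ', pow_succ', ih]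
      refine Eq.trans ?_ (leftMul_mul X _).symm
      congr 1
      rw [← monomial_one_one_eq_X, leftMul_monomial, pow_one]
      apply LinearMap.ext; intro q; simp
  change leftMul P.symbol Q.symbol = _
  rw [leftMul, Polynomial.sum_over_range' _ _ (P.order + 1) (Nat.lt_succ_self _),
    LinearMap.sum_apply]
  · refine Finset.sum_congr rfl fun i _ => ?_
    rw [Module.End.mul_apply, LinearMap.mulLeft_apply, h1, ← smul_eq_C_mul]
    rfl
  · intro i
    apply LinearMap.ext; intro q; simp

theorem coeff_D_pow_mul {P : DiffOp F} {n : ℕ} (hP : P.order ≤ n) (i : ℕ) :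
    (D ^ i * P).coeff (n + i) = P.coeff n ∧ (D ^ i * P).order ≤ n + i := by
  induction i with
  | zero => rw [pow_zero, one_mul]; exact ⟨rfl, hP⟩
  | succ i ih =>
    rw [pow_succ', mul_assoc]
    exact ⟨(coeff_D_mul_succ ih.2).trans ih.1, order_D_mul_le ih.2⟩

/-- The leading coefficient of a product is the product of the leading coefficients, since `D f - f
D` has order zero. -/
theorem order_le_order_mul {P L : DiffOp F} (hP : P ≠ 0) (hL : L ≠ 0) :
    L.order ≤ (P * L).order := by
  have h : (P * L).coeff (L.order + P.order) ≠ 0 := by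
    rw [mul_eq_sum, coeff_sum, Finset.sum_range_succ, Finset.sum_eq_zero, zero_add, coeff_smul,
      (coeff_D_pow_mul le_rfl P.order).1]
    · exact mul_ne_zero (coeff_order_ne_zero hP) (coeff_order_ne_zero hL)
    · intro i hi
      rw [Finset.mem_range] at hi
      rw [coeff_smul, coeff_eq_zero_of_order_lt (P := D ^ i * L)
        ((coeff_D_pow_mul le_rfl i).2.trans_lt (by omega)), mul_zero]
  by_contra hlt
  exact h (coeff_eq_zero_of_order_lt (by omega))

theorem D_mul_smul (f : F) (P : DiffOp F) :
    D * (f • P) = f • (D * P) + Differential.deriv f • P := by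
  have h := congrArg (· * P) (D_mul_smul_one f)
  simp only [add_mul, smul_mul_assoc, one_mul, mul_assoc] at h
  exact h

end Order

section Map

variable {F G : Type*} [Field F] [Field G] (φ : F →+* G)

theorem coeff_map (P : DiffOp F) (n : ℕ) : (P.map φ).coeff n = φ (P.coeff n) :=
  Polynomial.coeff_map φ n

theorem map_add (P Q : DiffOp F) : (P + Q).map φ = P.map φ + Q.map φ :=
  Polynomial.map_add φ

theorem map_smul (a : F) (P : DiffOp F) : (a • P).map φ = φ a • P.map φ :=
  Polynomial.map_smul φ a

theorem map_sum {κ : Type*} (s : Finset κ) (P : κ → DiffOp F) :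
    (∑ i ∈ s, P i).map φ = ∑ i ∈ s, (P i).map φ :=
  Polynomial.map_sum φ P s

theorem map_map {H : Type*} [Field H] (ψ : G →+* H) (P : DiffOp F) :
    (P.map φ).map ψ = P.map (ψ.comp φ) :=
  Polynomial.map_map φ ψ P.symbol

theorem order_map (P : DiffOp F) : (P.map φ).order = P.order :=
  natDegree_map φ

theorem map_D_mul [Differential F] [Differential G]
    (hφ : ∀ a, φ (Differential.deriv a) = Differential.deriv (φ a)) (P : DiffOp F) :
    (D * P).map φ = D * P.map φ := by
  change ((D * P).symbol).map φ = (D * P.map φ).symbol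
  rw [symbol_D_mul, symbol_D_mul, leftD_apply, leftD_apply, show (P.map φ).symbol = P.symbol.map φ from rfl,
    Polynomial.map_add, Polynomial.map_mul, map_X]
  congr 1
  ext n
  rw [Polynomial.coeff_map, Differential.coeff_mapCoeffs, Differential.coeff_mapCoeffs,
    Polynomial.coeff_map, hφ]

end Map

end DiffOp

/-! ### Residue classes -/

namespace OpQuotient

variable {K : Type*} [Field K] {L : DiffOp (RatFunc K)}

theorem mk_add (P Q : DiffOp (RatFunc K)) : (mk (P + Q) : OpQuotient L) = mk P + mk Q := rfl

theorem mk_sub (P Q : DiffOp (RatFunc K)) : (mk (P - Q) : OpQuotient L) = mk P - mk Q := rfl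

theorem mk_smul (a : RatFunc K) (P : DiffOp (RatFunc K)) :
    (mk (a • P) : OpQuotient L) = a • mk P := rfl

theorem mk_mul (P Q : DiffOp (RatFunc K)) : (mk (P * Q) : OpQuotient L) = P • mk Q := rfl

theorem mk_sum {κ : Type*} (s : Finset κ) (P : κ → DiffOp (RatFunc K)) :
    (mk (∑ i ∈ s, P i) : OpQuotient L) = ∑ i ∈ s, mk (P i) :=
  map_sum (Submodule.mkQ (Submodule.span (DiffOp (RatFunc K)) {L})) P s

theorem polynomial_smul (p : K[X]) (A : OpQuotient L) :
    p • A = algebraMap K[X] (RatFunc K) p • A := by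
  induction A using Submodule.Quotient.induction_on with | H P =>
  have h : p • P = algebraMap K[X] (RatFunc K) p • P :=
    (algebraMap_smul (A := RatFunc K) p (show (RatFunc K)[X] from P)).symm
  exact congrArg mk h

theorem mk_eq_mk_iff {P Q : DiffOp (RatFunc K)} :
    (mk P : OpQuotient L) = mk Q ↔ ∃ R, P = Q + R * L := by
  refine (Submodule.Quotient.eq _).trans ?_
  rw [Submodule.mem_span_singleton]
  constructor
  · rintro ⟨R, hR⟩
    exact ⟨R, by rw [smul_eq_mul] at hR; rw [hR]; abel⟩
  · rintro ⟨R, rfl⟩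
    exact ⟨R, by rw [smul_eq_mul]; abel⟩

/-- A nonzero multiple of `L` has order at least that of `L`. Uniqueness of the small representative
allows coefficients of classes to be compared. -/
theorem eq_of_mk_eq_mk {P Q : DiffOp (RatFunc K)} (h : (mk P : OpQuotient L) = mk Q)
    (hP : P.order < L.order) (hQ : Q.order < L.order) : P = Q := by
  obtain ⟨R, hR⟩ := mk_eq_mk_iff.1 h
  by_cases hR0 : R = 0
  · rw [hR, hR0, zero_mul, add_zero]
  · exfalso
    have hL : L ≠ 0 := fun h0 => by
      rw [h0] at hP
      exact Nat.not_lt_zero _ hP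
    have h1 := DiffOp.order_le_order_mul hR0 hL
    rw [show R * L = P - Q by rw [hR]; abel] at h1
    have h2 := DiffOp.order_sub_le (n := L.order - 1) (P := P) (Q := Q) (by omega) (by omega)
    omega

theorem exists_mk_eq (A : OpQuotient L) : ∃ P, mk P = A ∧ P.order = A.ord := by
  have h : {n | ∃ P : DiffOp (RatFunc K), mk P = A ∧ P.order = n}.Nonempty := by
    obtain ⟨P, hP⟩ := Submodule.Quotient.mk_surjective _ A
    exact ⟨P.order, P, hP, rfl⟩
  exact Nat.sInf_mem h

theorem ord_mk_le (P : DiffOp (RatFunc K)) : (mk P : OpQuotient L).ord ≤ P.order :=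
  Nat.sInf_le ⟨P, rfl, rfl⟩

variable {C : Type*} [Field C] [CharZero C] [Algebra C K] {ι : Threshold C}

/-- Representatives differ by a multiple of `L`, which kills all solutions, so a single one decides.
-/
theorem isIntegral_mk_iff (P : DiffOp (RatFunc K)) :
    (mk P : OpQuotient L).IsIntegral ι ↔ ∀ α, IntegralAt ι L α P := by
  constructor
  · intro h α
    exact (integralAt_iff ι L α P).2 (h P rfl α)
  · intro h Q hQ α
    obtain ⟨R, rfl⟩ := mk_eq_mk_iff.1 hQ
    exact (integralAt_iff ι L α _).1 ((h α).add (.of_mul R))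

end OpQuotient

/-! ### Extension of scalars and automorphisms -/

section RatMap

variable {F G : Type*} [Field F] [Field G]

/-- The map `F(x) → G(x)` induced by a homomorphism of fields. -/
noncomputable def ratMap (φ : F →+* G) : RatFunc F →+* RatFunc G :=
  RatFunc.mapRingHom (mapRingHom φ) <|
    nonZeroDivisors_le_comap_nonZeroDivisors_of_injective _ (map_injective φ φ.injective)

theorem ratMap_algebraMap (φ : F →+* G) (p : F[X]) :
    ratMap φ (algebraMap F[X] (RatFunc F) p) = algebraMap G[X] (RatFunc G) (p.map φ) := by
  have h := RatFunc.map_apply_div (mapRingHom φ)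
    (nonZeroDivisors_le_comap_nonZeroDivisors_of_injective _ (map_injective φ φ.injective)) p 1
  have h2 : ratMap φ (algebraMap F[X] (RatFunc F) p / algebraMap F[X] (RatFunc F) 1) =
      algebraMap G[X] (RatFunc G) (p.map φ) / algebraMap G[X] (RatFunc G) ((1 : F[X]).map φ) := h
  simpa using h2

theorem ratMap_comp {H : Type*} [Field H] (φ : F →+* G) (ψ : G →+* H) :
    (ratMap ψ).comp (ratMap φ) = ratMap (ψ.comp φ) := by
  ext f
  induction f using RatFunc.induction_on with | f p q hq =>
  simp only [RingHom.comp_apply, map_div₀, ratMap_algebraMap, Polynomial.map_map]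

theorem ratMap_deriv (φ : F →+* G) (f : RatFunc F) :
    ratMap φ (Differential.deriv f) = Differential.deriv (ratMap φ f) := by
  change ratMap φ (ratDeriv f) = ratDeriv (ratMap φ f)
  induction f using RatFunc.induction_on with | f p q hq =>
  rw [ratDeriv_div _ _ hq, map_div₀, map_div₀, map_pow, ratMap_algebraMap, ratMap_algebraMap,
    ratMap_algebraMap, ratDeriv_div _ _ ((Polynomial.map_ne_zero_iff φ.injective).2 hq)]
  simp only [Polynomial.map_sub, Polynomial.map_mul, derivative_map]

end RatMap

section SeriesMap

variable {K : Type*} [Field K]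

/-- Applying an endomorphism of the field to the coefficients of a Laurent series. -/
noncomputable def seriesMap (σ : K →+* K) : LaurentSeries K →+* LaurentSeries K where
  toFun x := x.map σ
  map_zero' := by ext n; simp
  map_one' := by
    ext n
    simp only [HahnSeries.map_coeff, HahnSeries.coeff_one]
    split_ifs <;> simp
  map_add' x y := by ext n; simp
  map_mul' x y := HahnSeries.map_mul (σ : K →ₙ+* K)

theorem coeff_seriesMap (σ : K →+* K) (x : LaurentSeries K) (n : ℤ) :
    (seriesMap σ x).coeff n = σ (x.coeff n) := rfl

theorem expandAt_ratMap (σ : K →+* K) (α : K) (a : RatFunc K) :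
    expandAt (σ α) (ratMap σ a) = seriesMap σ (expandAt α a) := by
  have h : ∀ p : K[X], expandAt (σ α) (algebraMap K[X] (RatFunc K) (p.map σ)) =
      seriesMap σ (expandAt α (algebraMap K[X] (RatFunc K) p)) := fun p => by
    ext n
    rw [coeff_seriesMap]
    rcases lt_or_ge n 0 with hn | hn
    · rw [coeff_expandAt_algebraMap_of_neg _ _ hn, coeff_expandAt_algebraMap_of_neg _ _ hn,
        map_zero]
    · lift n to ℕ using hn
      rw [expandAt_algebraMap, expandAt_algebraMap, LaurentSeries.coeff_coe_powerSeries,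
        LaurentSeries.coeff_coe_powerSeries, coeff_coe, coeff_coe, ← map_taylor, coeff_map]
  induction a using RatFunc.induction_on with | f p q hq =>
  simp only [map_div₀, ratMap_algebraMap, h]

theorem map_twistedDerivLin (σ : K →+* K) (c : K) (g : (LaurentSeries K)[X]) :
    (twistedDerivLin c g).map (seriesMap σ) = twistedDerivLin (σ c) (g.map (seriesMap σ)) := by
  ext j n
  simp only [coeff_map, coeff_seriesMap, coeff_twistedDerivLin, map_add, map_mul, map_intCast,
    map_natCast, map_one]

theorem map_opAct (σ : K →+* K) (c α : K) (P : DiffOp (RatFunc K)) (g : (LaurentSeries K)[X]) :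
    (opAct c α P g).map (seriesMap σ) =
      opAct (σ c) (σ α) (P.map (ratMap σ)) (g.map (seriesMap σ)) := by
  have h : ∀ i : ℕ, ((twistedDerivLin c ^ i) g).map (seriesMap σ) =
      (twistedDerivLin (σ c) ^ i) (g.map (seriesMap σ)) := fun i => by
    induction i with
    | zero => rfl
    | succ i ih =>
      rw [pow_succ', Module.End.mul_apply, map_twistedDerivLin, ih, pow_succ',
        Module.End.mul_apply]
  rw [opAct_eq_sum c α P (Nat.lt_succ_self _), opAct_eq_sum _ _ _ (n := P.order + 1)
    (by rw [DiffOp.order_map]; exact Nat.lt_succ_self _), Polynomial.map_sum]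
  refine Finset.sum_congr rfl fun i _ => ?_
  rw [Polynomial.map_mul, map_C, h, DiffOp.coeff_map, expandAt_ratMap]

/-- Acting on coefficients, `σ` carries the solutions at `α` bijectively to those at `σ α`, because
`L` is fixed. Exponents lie in `C` and are fixed as well, so the thresholds agree. -/
theorem IntegralAt.map {C : Type*} [Field C] [Algebra C K] {ι : Threshold C}
    {L P : DiffOp (RatFunc K)} {α : K} (σ : K ≃ₐ[C] K) (hL : L.map (ratMap (σ : K →+* K)) = L)
    (hP : IntegralAt ι L α P) : IntegralAt ι L (σ α) (P.map (ratMap (σ : K →+* K))) := by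
  intro ν g hg n j hn
  have hν : (σ : K →+* K) (algebraMap C K ν) = algebraMap C K ν := σ.commutes ν
  obtain ⟨h, rfl⟩ : ∃ h : (LaurentSeries K)[X], h.map (seriesMap (σ : K →+* K)) = g := by
    refine ⟨g.map (seriesMap (σ.symm : K →+* K)), ?_⟩
    ext i m
    simp [coeff_seriesMap]
  have hinj : Function.Injective (seriesMap (σ : K →+* K)) := (seriesMap (σ : K →+* K)).injective
  have hact : ∀ Q : DiffOp (RatFunc K), opAct (algebraMap C K ν) (σ α)
      (Q.map (ratMap (σ : K →+* K))) (h.map (seriesMap (σ : K →+* K))) =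
      (opAct (algebraMap C K ν) α Q h).map (seriesMap (σ : K →+* K)) := fun Q => by
    rw [map_opAct, hν]; rfl
  have h0 : opAct (algebraMap C K ν) α L h = 0 := by
    have h1 := hact L
    rw [hL, hg] at h1
    exact (Polynomial.map_eq_zero_iff hinj).1 h1.symm
  rw [hact, coeff_map, coeff_seriesMap, hP ν h h0 n j hn, map_zero]

end SeriesMap

section BaseChange

variable {C K : Type*} [Field C] [Field K] [Algebra C K]

theorem ratInc_eq_ratMap : ratInc (C := C) K = ratMap (algebraMap C K) := rfl

theorem baseChange_map (L : DiffOp C[X]) (σ : K ≃ₐ[C] K) :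
    (baseChange K L).map (ratMap (σ : K →+* K)) = baseChange K L := by
  have h : (ratMap (σ : K →+* K)).comp ((algebraMap K[X] (RatFunc K)).comp (polyInc K)) =
      (algebraMap K[X] (RatFunc K)).comp (polyInc (C := C) K) := by
    refine RingHom.ext fun p => ?_
    rw [RingHom.comp_apply, RingHom.comp_apply, ratMap_algebraMap]
    congr 1
    change (p.map _).map _ = p.map _
    rw [Polynomial.map_map]
    congr 1
    exact RingHom.ext fun c => σ.commutes c
  refine (Polynomial.map_map _ _ L.symbol).trans ?_
  rw [h]
  rfl

theorem map_ratInc_map (P : DiffOp (RatFunc C)) (σ : K ≃ₐ[C] K) :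
    (P.map (ratInc K)).map (ratMap (σ : K →+* K)) = P.map (ratInc K) := by
  rw [DiffOp.map_map, ratInc_eq_ratMap, ratMap_comp]
  congr 2
  exact RingHom.ext fun c => σ.commutes c

theorem algebraMap_comp_polyInc_injective :
    Function.Injective ((algebraMap K[X] (RatFunc K)).comp (polyInc (C := C) K)) :=
  (RatFunc.algebraMap_injective K).comp (map_injective _ (algebraMap C K).injective)

theorem order_baseChange (L : DiffOp C[X]) : (baseChange K L).order = L.order :=
  natDegree_map_eq_of_injective algebraMap_comp_polyInc_injective L.symbol

/-- The coefficients of `L` are polynomials, so only roots of the leading one can fail to be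
ordinary. -/
theorem isOrdinary_baseChange (L : DiffOp C[X]) {α : K} (hα : aeval α L.leadingCoeff ≠ 0) :
    IsOrdinary α (baseChange K L) := by
  have h : ∀ i, (baseChange K L).coeff i = algebraMap K[X] (RatFunc K) (polyInc K (L.coeff i)) :=
    fun i => Polynomial.coeff_map _ i
  refine ⟨fun i k hk => ?_, ?_⟩
  · rw [h]
    exact coeff_expandAt_algebraMap_of_neg _ _ hk
  · rw [order_baseChange, h, coeff_zero_expandAt_algebraMap]
    change (map (algebraMap C K) L.leadingCoeff).eval α ≠ 0
    rwa [eval_map_algebraMap]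

end BaseChange

/-! ### The order of a rational function at a point -/

section Valuation

variable {K : Type*} [Field K]

/-- The order of vanishing of a rational function at a point. -/
noncomputable def valAt (α : K) (f : RatFunc K) : ℤ := (expandAt α f).order

theorem valAt_mul (α : K) {f g : RatFunc K} (hf : f ≠ 0) (hg : g ≠ 0) :
    valAt α (f * g) = valAt α f + valAt α g := by
  rw [valAt, map_mul, HahnSeries.order_mul ((_root_.map_ne_zero _).2 hf)
    ((_root_.map_ne_zero _).2 hg)]
  rfl

theorem valAt_nonneg_iff (α : K) (f : RatFunc K) :
    0 ≤ valAt α f ↔ ∀ k < 0, (expandAt α f).coeff k = 0 := by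
  constructor
  · intro h k hk
    exact HahnSeries.coeff_eq_zero_of_lt_order (hk.trans_le h)
  · intro h
    by_cases h0 : expandAt α f = 0
    · rw [valAt, h0, HahnSeries.order_zero]
    · by_contra hlt
      exact HahnSeries.coeff_order_eq_zero.not.2 h0 (h _ (not_le.1 hlt))

theorem valAt_algebraMap_nonneg (α : K) (p : K[X]) :
    0 ≤ valAt α (algebraMap K[X] (RatFunc K) p) :=
  (valAt_nonneg_iff α _).2 fun _ hk => coeff_expandAt_algebraMap_of_neg α p hk

theorem valAt_algebraMap_of_eval_ne_zero {α : K} {p : K[X]} (hp : p.eval α ≠ 0) :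
    valAt α (algebraMap K[X] (RatFunc K) p) = 0 := by
  refine le_antisymm ?_ (valAt_algebraMap_nonneg α p)
  refine HahnSeries.order_le_of_coeff_ne_zero ?_
  rwa [coeff_zero_expandAt_algebraMap]

theorem valAt_one (α : K) : valAt α 1 = 0 := by
  rw [valAt, map_one, HahnSeries.order_one]

theorem valAt_inv (α : K) {f : RatFunc K} (hf : f ≠ 0) : valAt α f⁻¹ = -valAt α f := by
  have h := valAt_mul α hf (inv_ne_zero hf)
  rw [mul_inv_cancel₀ hf, valAt_one] at h
  omega

theorem valAt_pos_of_eval_eq_zero {α : K} {p : K[X]} (hp0 : p ≠ 0) (hp : p.eval α = 0) :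
    1 ≤ valAt α (algebraMap K[X] (RatFunc K) p) := by
  have h := valAt_algebraMap_nonneg α p
  refine Int.add_one_le_iff.2 (lt_of_le_of_ne h fun h0 => ?_)
  refine HahnSeries.coeff_order_eq_zero.not.2
    ((_root_.map_ne_zero (expandAt α)).2 (RatFunc.algebraMap_ne_zero hp0)) ?_
  change (expandAt α (algebraMap K[X] (RatFunc K) p)).coeff
    (valAt α (algebraMap K[X] (RatFunc K) p)) = 0
  rw [← h0, coeff_zero_expandAt_algebraMap, hp]

theorem valAt_X_sub_C (α : K) : valAt α (algebraMap K[X] (RatFunc K) (X - C α)) = 1 := by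
  refine le_antisymm ?_ (valAt_pos_of_eval_eq_zero (X_sub_C_ne_zero α) (by simp))
  refine HahnSeries.order_le_of_coeff_ne_zero ?_
  have h := LaurentSeries.coeff_coe_powerSeries ((taylor α (X - C α) : K[X]) : PowerSeries K) 1
  rw [expandAt_algebraMap]
  rw [Nat.cast_one] at h
  rw [h]
  simp

end Valuation

/-! ### Integral elements -/

namespace OpQuotient

section Closure

variable {C K : Type*} [Field C] [CharZero C] [Field K] [Algebra C K] {ι : Threshold C}
  {L : DiffOp (RatFunc K)}

theorem IsIntegral.sub {A A' : OpQuotient L} (hA : A.IsIntegral ι) (hA' : A'.IsIntegral ι) :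
    (A - A').IsIntegral ι := by
  obtain ⟨P, rfl, -⟩ := A.exists_mk_eq
  obtain ⟨Q, rfl, -⟩ := A'.exists_mk_eq
  rw [← mk_sub, isIntegral_mk_iff]
  rw [isIntegral_mk_iff] at hA hA'
  exact fun α => (hA α).sub (hA' α)

theorem IsIntegral.polynomial_smul {A : OpQuotient L} (hA : A.IsIntegral ι) (p : K[X]) :
    (p • A).IsIntegral ι := by
  obtain ⟨P, rfl, -⟩ := A.exists_mk_eq
  rw [OpQuotient.polynomial_smul, ← mk_smul, isIntegral_mk_iff]
  rw [isIntegral_mk_iff] at hA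
  exact fun α => (hA α).smul fun k hk => coeff_expandAt_algebraMap_of_neg α p hk

theorem IsIntegral.add {A A' : OpQuotient L} (hA : A.IsIntegral ι) (hA' : A'.IsIntegral ι) :
    (A + A').IsIntegral ι := by
  have h := hA.sub (hA'.polynomial_smul (-1))
  rwa [neg_one_smul, sub_neg_eq_add] at h

theorem IsIntegral.zero : (0 : OpQuotient L).IsIntegral ι :=
  (isIntegral_mk_iff (ι := ι) 0).2 fun _ => .zero

theorem IsIntegral.sum {κ : Type*} {s : Finset κ} {A : κ → OpQuotient L}
    (h : ∀ i ∈ s, (A i).IsIntegral ι) : (∑ i ∈ s, A i).IsIntegral ι := by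
  classical
  induction s using Finset.induction_on with
  | empty => exact .zero
  | insert i s hi ih =>
    rw [Finset.sum_insert hi]
    exact (h i (Finset.mem_insert_self i s)).add
      (ih fun j hj => h j (Finset.mem_insert_of_mem hj))

end Closure

section BaseChange

variable {C K : Type*} [Field C] [CharZero C] [Field K] [Algebra C K] {ι : Threshold C}
  {L : DiffOp C[X]} {s : C[X]}

omit [CharZero C] in
theorem aeval_eq_zero_of_squarefreePart (hL : L.leadingCoeff ≠ 0)
    (hs : IsSquarefreePart s L.leadingCoeff) {α : K} (hα : aeval α L.leadingCoeff = 0) :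
    aeval α s = 0 := by
  have hint : _root_.IsIntegral C α := isAlgebraic_iff_isIntegral.1 ⟨_, hL, hα⟩
  exact (minpoly.dvd_iff).1 (hs.2.2 _ (minpoly.irreducible hint) (minpoly.dvd C α hα))

/-- At a root of the leading coefficient `s` vanishes and absorbs the one pole that `D` may add; at
other points `D` adds none. -/
theorem IsIntegral.smul_D_smul (hL : L.leadingCoeff ≠ 0) (hs : IsSquarefreePart s L.leadingCoeff)
    {A : OpQuotient (baseChange K L)} (hA : A.IsIntegral ι) :
    (polyInc K s • (DiffOp.D : DiffOp (RatFunc K)) • A).IsIntegral ι := by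
  obtain ⟨P, rfl, -⟩ := A.exists_mk_eq
  rw [OpQuotient.polynomial_smul, ← mk_mul, ← mk_smul, isIntegral_mk_iff]
  rw [isIntegral_mk_iff] at hA
  intro α
  by_cases hα : aeval α L.leadingCoeff = 0
  · refine (hA α).smul_D_mul fun k hk => ?_
    rcases (Int.le_of_lt_add_one hk : k ≤ 0).lt_or_eq with hk | rfl
    · exact coeff_expandAt_algebraMap_of_neg _ _ hk
    · rw [coeff_zero_expandAt_algebraMap]
      change (map (algebraMap C K) s).eval α = 0
      rw [eval_map_algebraMap, aeval_eq_zero_of_squarefreePart hL hs hα]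
  · exact ((hA α).D_mul_of_ordinary (isOrdinary_baseChange L hα)).smul fun k hk =>
      coeff_expandAt_algebraMap_of_neg _ _ hk

theorem deriv_algebraMap (p : K[X]) : Differential.deriv (algebraMap K[X] (RatFunc K) p) =
    algebraMap K[X] (RatFunc K) (derivative p) := by
  have h := ratDeriv_div p 1 one_ne_zero
  refine Eq.trans ?_ (h.trans ?_)
  · rw [map_one, div_one]; rfl
  · simp

theorem IsIntegral.pow_smul_D_pow_smul (hL : L.leadingCoeff ≠ 0)
    (hs : IsSquarefreePart s L.leadingCoeff) {A : OpQuotient (baseChange K L)}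
    (hA : A.IsIntegral ι) (k : ℕ) :
    (polyInc K s ^ k • (DiffOp.D : DiffOp (RatFunc K)) ^ k • A).IsIntegral ι := by
  induction k with
  | zero => simpa using hA
  | succ k ih =>
    -- This uses `s ^ (k+1) D ^ (k+1) = s D (s ^ k D ^ k) - k s' s ^ k D ^ k`.
    have h1 := (ih.smul_D_smul hL hs).sub (ih.polynomial_smul (k • derivative (polyInc K s)))
    obtain ⟨P, rfl, -⟩ := A.exists_mk_eq
    convert h1 using 1
    set p := polyInc K s
    simp only [OpQuotient.polynomial_smul, ← mk_smul, ← mk_mul, ← mk_sub]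
    congr 1
    rw [DiffOp.D_mul_smul, deriv_algebraMap, smul_add, smul_smul, smul_smul, smul_smul, pow_succ',
      pow_succ' DiffOp.D k, mul_assoc DiffOp.D, derivative_pow]
    rw [eq_sub_iff_add_eq, map_mul]
    congr 2
    cases k with
    | zero => simp
    | succ k =>
      rw [← map_mul, ← map_mul]
      congr 1
      simp only [nsmul_eq_mul, Nat.add_sub_cancel, pow_succ', C_eq_natCast]
      ring

theorem IsIntegral.valAt_nonneg {P : DiffOp (RatFunc K)}
    (hP : (mk P : OpQuotient (baseChange K L)).IsIntegral ι) (hord : P.order < L.order) {α : K}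
    (hα : aeval α L.leadingCoeff ≠ 0) (i : ℕ) : 0 ≤ valAt α (P.coeff i) := by
  rw [isIntegral_mk_iff] at hP
  rw [valAt_nonneg_iff]
  exact (hP α).coeff_expandAt_eq_zero (isOrdinary_baseChange L hα)
    (by rwa [order_baseChange]) i

end BaseChange

end OpQuotient

/-! ### Triangular families -/

/-- No `P j` with `j > i` can occur: for the largest such `j`, nothing cancels its `D ^ j`
coefficient. -/
theorem DiffOp.coeff_triangular_sum {F : Type*} [Field F] {d : ℕ} {P : ℕ → DiffOp F}
    (hP : ∀ j < d, (P j).order = j) (hP0 : ∀ j < d, P j ≠ 0) (g : ℕ → F) {i : ℕ} (hi : i < d)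
    (hord : (∑ j ∈ Finset.range d, g j • P j).order ≤ i) :
    (∑ j ∈ Finset.range d, g j • P j).coeff i = g i * (P i).coeff i := by
  have key : ∀ k < d, (∀ j < d, k < j → g j = 0) →
      (∑ j ∈ Finset.range d, g j • P j).coeff k = g k * (P k).coeff k := fun k hk hz => by
    rw [DiffOp.coeff_sum, Finset.sum_eq_single k, DiffOp.coeff_smul]
    · intro j hj hjk
      rw [Finset.mem_range] at hj
      rw [DiffOp.coeff_smul]
      rcases lt_or_gt_of_ne hjk with h | h
      · rw [DiffOp.coeff_eq_zero_of_order_lt (by rwa [hP j hj]), mul_zero]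
      · rw [hz j hj h, zero_mul]
    · intro h
      exact absurd (Finset.mem_range.2 hk) h
  classical
  refine key i hi ?_
  by_contra! hcon
  obtain ⟨j, hjd, hij, hj⟩ := hcon
  set T := (Finset.range d).filter fun j => i < j ∧ g j ≠ 0
  have hT : T.Nonempty := ⟨j, by simp [T, hjd, hij, hj]⟩
  have hm := T.max'_mem hT
  set m := T.max' hT with hmdef
  obtain ⟨hmd, him, hgm⟩ : m < d ∧ i < m ∧ g m ≠ 0 := by simpa [T] using hm
  have h := key m hmd fun k hk hmk => by
    by_contra hgk
    have := T.le_max' k (by simp [T, hk, hgk, him.trans hmk])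
    omega
  rw [DiffOp.coeff_eq_zero_of_order_lt (hord.trans_lt him)] at h
  have hne := DiffOp.coeff_order_ne_zero (hP0 m hmd)
  rw [hP m hmd] at hne
  exact mul_ne_zero hgm hne h.symm

theorem Submodule.mem_span_image_Iio {R M : Type*} [Ring R] [AddCommGroup M] [Module R M]
    {B : ℕ → M} {d : ℕ} {x : M} : x ∈ Submodule.span R (B '' Set.Iio d) ↔
      ∃ c : ℕ → R, ∑ i ∈ Finset.range d, c i • B i = x := by
  rw [← Finset.coe_range, Submodule.mem_span_image_finset_iff_exists_fun']

theorem LinearIndependent.eq_of_sum_range {R M : Type*} [Ring R] [AddCommGroup M] [Module R M]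
    {B : ℕ → M} {d : ℕ} (hB : LinearIndependent R fun i : Fin d => B i) {c c' : ℕ → R}
    (h : ∑ i ∈ Finset.range d, c i • B i = ∑ i ∈ Finset.range d, c' i • B i) {i : ℕ} (hi : i < d) :
    c i = c' i := by
  rw [← sub_eq_zero, ← Finset.sum_sub_distrib, Finset.sum_range] at h
  simp only [← sub_smul] at h
  exact sub_eq_zero.1 (Fintype.linearIndependent_iff.1 hB (fun i => c i - c' i) h ⟨i, hi⟩)

/-! ### Bases of the integral elements of bounded order -/

section Basis

variable {C K : Type*} [Field C] [CharZero C] [Field K] [Algebra C K]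

/-- `B₀, …, B_{d-1}` is a basis of the module of integral elements of order less than `d`, and
`Bᵢ` has order `i`. -/
structure IsOrderBasis (ι : Threshold C) (L : DiffOp C[X]) (d : ℕ)
    (B : ℕ → OpQuotient (baseChange K L)) : Prop where
  pos : 1 ≤ d
  lt_order : d < L.order
  ord_eq : ∀ i < d, (B i).ord = i
  linearIndependent : LinearIndependent K[X] fun i : Fin d => B i
  span_eq : (Submodule.span K[X] (B '' Set.Iio d) : Set (OpQuotient (baseChange K L))) =
    {A | A.IsIntegral ι ∧ A.ord < d}

/-- The class `A` has order `n`, and the coefficient of `D ^ n` does not vanish at points which are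
not roots of the leading coefficient of `L`. -/
def HasLeading (L : DiffOp C[X]) (n : ℕ) (A : OpQuotient (baseChange K L)) : Prop :=
  ∃ P, OpQuotient.mk P = A ∧ P.order ≤ n ∧ P.coeff n ≠ 0 ∧
    ∀ α : K, aeval α L.leadingCoeff ≠ 0 → valAt α (P.coeff n) ≤ 0

variable {ι : Threshold C} {L : DiffOp C[X]} {d : ℕ} {B : ℕ → OpQuotient (baseChange K L)}

namespace IsOrderBasis

omit [CharZero C] in
theorem leadingCoeff_ne_zero (hB : IsOrderBasis ι L d B) : L.leadingCoeff ≠ 0 := fun h => by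
  have h1 := hB.lt_order
  rw [DiffOp.leadingCoeff, Polynomial.leadingCoeff_eq_zero] at h
  rw [DiffOp.order, h] at h1
  exact Nat.not_lt_zero _ h1

omit [CharZero C] in
theorem exists_operators (hB : IsOrderBasis ι L d B) : ∃ P : ℕ → DiffOp (RatFunc K),
    (∀ i, OpQuotient.mk (P i) = B i) ∧ (∀ i < d, (P i).order = i) ∧ ∀ i < d, P i ≠ 0 := by
  choose P hP hord using fun i => (B i).exists_mk_eq
  refine ⟨P, hP, fun i hi => (hord i).trans (hB.ord_eq i hi), fun i hi h0 => ?_⟩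
  have h1 := hP i
  rw [h0] at h1
  exact hB.linearIndependent.ne_zero ⟨i, hi⟩ h1.symm

omit [CharZero C] in
theorem isIntegral (hB : IsOrderBasis ι L d B) {i : ℕ} (hi : i < d) : (B i).IsIntegral ι := by
  have h : B i ∈ (Submodule.span K[X] (B '' Set.Iio d) : Set (OpQuotient (baseChange K L))) :=
    Submodule.subset_span ⟨i, hi, rfl⟩
  rw [hB.span_eq] at h
  exact h.1

omit [CharZero C] in
theorem exists_eq_sum (hB : IsOrderBasis ι L d B) {A : OpQuotient (baseChange K L)}
    (hA : A.IsIntegral ι) (hord : A.ord < d) :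
    ∃ c : ℕ → K[X], ∑ i ∈ Finset.range d, c i • B i = A := by
  rw [← Submodule.mem_span_image_Iio, ← SetLike.mem_coe, hB.span_eq]
  exact ⟨hA, hord⟩

/-- If the coefficient of `B₀` vanished at an ordinary `α`, then `(x - α)⁻¹ B₀` would be integral of
order `0`. Expanding it in the basis would contradict linear independence. -/
theorem hasLeading_zero (hB : IsOrderBasis ι L d B) : HasLeading L 0 (B 0) := by
  obtain ⟨P, hP, hord, hP0⟩ := hB.exists_operators
  have h0 : 0 < d := hB.pos
  have hc : (P 0).coeff 0 ≠ 0 := by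
    have h := DiffOp.coeff_order_ne_zero (hP0 0 h0)
    rwa [hord 0 h0] at h
  refine ⟨P 0, hP 0, (hord 0 h0).le, hc, fun α hα => ?_⟩
  by_contra! hval
  set x := algebraMap K[X] (RatFunc K) (X - Polynomial.C α) with hx
  have hx0 : x ≠ 0 := RatFunc.algebraMap_ne_zero (X_sub_C_ne_zero α)
  have hP1 : P 0 = (P 0).coeff 0 • (1 : DiffOp (RatFunc K)) := by
    have h := eq_C_of_natDegree_eq_zero (p := (P 0).symbol) (hord 0 h0)
    refine h.trans ?_
    rw [← mul_one (Polynomial.C _), ← smul_eq_C_mul]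
    rfl
  have hint0 := hB.isIntegral h0
  rw [← hP 0, OpQuotient.isIntegral_mk_iff] at hint0
  have hint : (OpQuotient.mk (x⁻¹ • P 0) : OpQuotient (baseChange K L)).IsIntegral ι := by
    rw [OpQuotient.isIntegral_mk_iff]
    intro β
    rcases eq_or_ne β α with rfl | hβ
    · rw [hP1, smul_smul]
      refine (IntegralAt.one_of_ordinary (isOrdinary_baseChange L hα)).smul ?_
      rw [← valAt_nonneg_iff, valAt_mul β (inv_ne_zero hx0) hc, valAt_inv β hx0, valAt_X_sub_C]
      omega
    · refine (hint0 β).smul ?_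
      rw [← valAt_nonneg_iff, valAt_inv β hx0, valAt_algebraMap_of_eval_ne_zero
        (by simpa [sub_eq_zero] using hβ), neg_zero]
  obtain ⟨c, hc⟩ := hB.exists_eq_sum hint
    ((OpQuotient.ord_mk_le _).trans_lt ((DiffOp.order_smul_le _ (hord 0 h0).le).trans_lt h0))
  have h1 : ∑ i ∈ Finset.range d, ((X - Polynomial.C α) * c i) • B i =
      ∑ i ∈ Finset.range d, (Pi.single 0 1 : ℕ → K[X]) i • B i := by
    rw [Finset.sum_eq_single_of_mem (f := fun i => (Pi.single 0 1 : ℕ → K[X]) i • B i) 0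
      (Finset.mem_range.2 h0) fun j _ hj => by rw [Pi.single_eq_of_ne hj, zero_smul]]
    simp only [mul_smul, ← Finset.smul_sum]
    rw [hc, OpQuotient.polynomial_smul, ← hx, ← OpQuotient.mk_smul, smul_smul,
      mul_inv_cancel₀ hx0, one_smul, Pi.single_eq_same, one_smul, hP]
  have h2 := congrArg (eval α) (hB.linearIndependent.eq_of_sum_range h1 h0)
  simp at h2

/-- The integral element `s D Bᵢ` is a combination of basis elements. Comparing coefficients of `D ^
(i + 1)` writes `s` times the leading coefficient of `Bᵢ` as a polynomial times that of `B_{i+1}`.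
Where `s ≠ 0`, the order of vanishing thus cannot grow with `i`. -/
theorem hasLeading (hB : IsOrderBasis ι L d B) {s : C[X]}
    (hs : IsSquarefreePart s L.leadingCoeff) {i : ℕ} (hi : i < d) : HasLeading L i (B i) := by
  induction i with
  | zero => exact hB.hasLeading_zero
  | succ i ih =>
    obtain ⟨Q, hQ, hQord, hQ0, hQval⟩ := ih (by omega)
    obtain ⟨P, hP, hord, hP0⟩ := hB.exists_operators
    have hPc : (P (i + 1)).coeff (i + 1) ≠ 0 := by
      have h := DiffOp.coeff_order_ne_zero (hP0 _ hi)
      rwa [hord _ hi] at h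
    have hint := (hB.isIntegral (show i < d by omega)).smul_D_smul hB.leadingCoeff_ne_zero hs
    set s' := algebraMap K[X] (RatFunc K) (polyInc K s) with hs'
    have hmk : polyInc K s • (DiffOp.D : DiffOp (RatFunc K)) • B i =
        OpQuotient.mk (s' • (DiffOp.D * Q)) := by
      rw [OpQuotient.mk_smul, OpQuotient.mk_mul, hQ, OpQuotient.polynomial_smul]
    have hordD : (s' • (DiffOp.D * Q)).order ≤ i + 1 :=
      DiffOp.order_smul_le _ (DiffOp.order_D_mul_le hQord)
    rw [hmk] at hint
    obtain ⟨c, hc⟩ := hB.exists_eq_sum hint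
      ((OpQuotient.ord_mk_le _).trans_lt (hordD.trans_lt hi))
    have hop : s' • (DiffOp.D * Q) =
        ∑ j ∈ Finset.range d, algebraMap K[X] (RatFunc K) (c j) • P j := by
      have hlt := hB.lt_order
      have hpos := hB.pos
      refine OpQuotient.eq_of_mk_eq_mk (L := baseChange K L) ?_ ?_ ?_
      · rw [← hc, OpQuotient.mk_sum]
        refine Finset.sum_congr rfl fun j _ => ?_
        rw [OpQuotient.mk_smul, hP, OpQuotient.polynomial_smul]
      · rw [order_baseChange]; omega
      · rw [order_baseChange]
        refine lt_of_le_of_lt (DiffOp.order_sum_le (n := d) fun j hj => ?_) hlt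
        rw [Finset.mem_range] at hj
        exact DiffOp.order_smul_le _ (by rw [hord j hj]; omega)
    have hcoeff := DiffOp.coeff_triangular_sum hord hP0
      (fun j => algebraMap K[X] (RatFunc K) (c j)) hi (by rw [← hop]; exact hordD)
    rw [← hop, DiffOp.coeff_smul, DiffOp.coeff_D_mul_succ hQord] at hcoeff
    have hs0 : s ≠ 0 := hs.1.ne_zero
    have hs'0 : s' ≠ 0 := RatFunc.algebraMap_ne_zero
      ((Polynomial.map_ne_zero_iff (algebraMap C K).injective).2 hs0)
    have hc0 : algebraMap K[X] (RatFunc K) (c (i + 1)) ≠ 0 := fun h => by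
      rw [h, zero_mul] at hcoeff
      exact mul_ne_zero hs'0 hQ0 hcoeff
    refine ⟨P (i + 1), hP _, (hord _ hi).le, hPc, fun α hα => ?_⟩
    have hsα : valAt α s' = 0 := by
      refine valAt_algebraMap_of_eval_ne_zero ?_
      change (map (algebraMap C K) s).eval α ≠ 0
      rw [eval_map_algebraMap]
      exact fun h => hα (by obtain ⟨t, ht⟩ := hs.2.1; rw [ht, map_mul, h, zero_mul])
    have h1 := congrArg (valAt α) hcoeff
    rw [valAt_mul α hs'0 hQ0, valAt_mul α hc0 hPc, hsα] at h1
    have h2 := hQval α hα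
    have h3 := valAt_algebraMap_nonneg α (c (i + 1))
    omega

end IsOrderBasis

/-- The properties of the values of `B_d` in the algorithm that are needed below. -/
structure IsCandidate (ι : Threshold C) (L : DiffOp C[X]) (d : ℕ)
    (Y : OpQuotient (baseChange K L)) : Prop where
  definedOver : Y.DefinedOver C
  isIntegral : Y.IsIntegral ι
  hasLeading : HasLeading L d Y

/-- The linear combination `g * (h₀ B₀ + ⋯ + h_{d-1} B_{d-1} + Y)`. -/
noncomputable def combination (d : ℕ) (B : ℕ → OpQuotient (baseChange K L))
    (Y : OpQuotient (baseChange K L)) (g : RatFunc K) (h : ℕ → K[X]) :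
    OpQuotient (baseChange K L) :=
  g • (∑ i ∈ Finset.range d, h i • B i + Y)

omit [CharZero C] in
theorem combination_eq_mk {Y : OpQuotient (baseChange K L)} {P : ℕ → DiffOp (RatFunc K)}
    (hP : ∀ i < d, OpQuotient.mk (P i) = B i) {Q : DiffOp (RatFunc K)} (hQ : OpQuotient.mk Q = Y)
    (g : RatFunc K) (h : ℕ → K[X]) : combination d B Y g h =
      OpQuotient.mk (g • (∑ i ∈ Finset.range d, algebraMap K[X] (RatFunc K) (h i) • P i + Q)) := by
  rw [OpQuotient.mk_smul, OpQuotient.mk_add, OpQuotient.mk_sum, hQ, combination]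
  congr 2
  refine Finset.sum_congr rfl fun i hi => ?_
  rw [OpQuotient.mk_smul, hP i (Finset.mem_range.1 hi), OpQuotient.polynomial_smul]

omit [CharZero C] in
-- Each `Bᵢ` has order below `d`, so the `D ^ d` coefficient comes from `Y` alone.
theorem IsOrderBasis.exists_combination_eq_mk (hB : IsOrderBasis ι L d B)
    {Y : OpQuotient (baseChange K L)} {Q : DiffOp (RatFunc K)} (hQ : OpQuotient.mk Q = Y)
    (hQord : Q.order ≤ d) (g : RatFunc K) (h : ℕ → K[X]) :
    ∃ R : DiffOp (RatFunc K), OpQuotient.mk R = combination d B Y g h ∧ R.order ≤ d ∧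
      R.coeff d = g * Q.coeff d := by
  obtain ⟨P, hP, hord, -⟩ := hB.exists_operators
  refine ⟨_, (combination_eq_mk (fun i _ => hP i) hQ g h).symm,
    DiffOp.order_smul_le _ (DiffOp.order_add_le (DiffOp.order_sum_le fun i hi => ?_) hQord), ?_⟩
  · rw [Finset.mem_range] at hi
    exact DiffOp.order_smul_le _ (by rw [hord i hi]; omega)
  · rw [DiffOp.coeff_smul, DiffOp.coeff_add, DiffOp.coeff_sum, Finset.sum_eq_zero, zero_add]
    intro i hi
    rw [Finset.mem_range] at hi
    rw [DiffOp.coeff_smul, DiffOp.coeff_eq_zero_of_order_lt (by rwa [hord i hi]), mul_zero]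

omit [CharZero C] in
theorem refinement_eq_combination (Y : OpQuotient (baseChange K L)) (p : C[X]) (a : ℕ → C[X]) :
    refinement d B Y p a = combination d B Y
      (algebraMap K[X] (RatFunc K) (polyInc K p))⁻¹ fun i => polyInc K (a i) := rfl

omit [CharZero C] in
theorem DiffOp.map_D_pow_mul (P : DiffOp (RatFunc C)) (k : ℕ) :
    (DiffOp.D ^ k * P).map (ratInc K) = DiffOp.D ^ k * P.map (ratInc K) := by
  induction k with
  | zero => simp
  | succ k ih =>
    rw [pow_succ', pow_succ', mul_assoc, mul_assoc, ← ih]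
    exact DiffOp.map_D_mul (ratInc K) (ratMap_deriv (algebraMap C K)) _

omit [CharZero C] in
theorem ratInc_algebraMap (p : C[X]) : ratInc K (algebraMap C[X] (RatFunc C) p) =
    algebraMap K[X] (RatFunc K) (polyInc K p) :=
  ratMap_algebraMap (algebraMap C K) p

omit [CharZero C] in
theorem definedOver_smul_D_pow {A : OpQuotient (baseChange K L)} (hA : A.DefinedOver C)
    (s : C[X]) (k : ℕ) :
    OpQuotient.DefinedOver C (polyInc K s • (DiffOp.D : DiffOp (RatFunc K)) ^ k • A) := by
  obtain ⟨P, rfl⟩ := hA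
  refine ⟨algebraMap C[X] (RatFunc C) s • (DiffOp.D ^ k * P), ?_⟩
  rw [DiffOp.map_smul, DiffOp.map_D_pow_mul, ratInc_algebraMap, OpQuotient.mk_smul,
    OpQuotient.mk_mul, OpQuotient.polynomial_smul]

omit [CharZero C] in
theorem hasLeading_smul_D_pow {A : OpQuotient (baseChange K L)} {n : ℕ} (hA : HasLeading L n A)
    {s : C[X]} (hs0 : s ≠ 0) (hs : s ∣ L.leadingCoeff) (e k : ℕ) :
    HasLeading L (n + k) (polyInc K s ^ e • (DiffOp.D : DiffOp (RatFunc K)) ^ k • A) := by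
  obtain ⟨P, rfl, hord, h0, hval⟩ := hA
  have hs' : polyInc K s ≠ 0 := (Polynomial.map_ne_zero_iff (algebraMap C K).injective).2 hs0
  have hs'' := RatFunc.algebraMap_ne_zero (pow_ne_zero e hs')
  have hD := DiffOp.coeff_D_pow_mul hord k
  refine ⟨algebraMap K[X] (RatFunc K) (polyInc K s ^ e) • (DiffOp.D ^ k * P), ?_,
    DiffOp.order_smul_le _ hD.2, ?_, fun α hα => ?_⟩
  · rw [OpQuotient.polynomial_smul, OpQuotient.mk_smul, OpQuotient.mk_mul]
  · rw [DiffOp.coeff_smul, hD.1]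
    exact mul_ne_zero hs'' h0
  · rw [DiffOp.coeff_smul, hD.1, valAt_mul α hs'' h0, valAt_algebraMap_of_eval_ne_zero, zero_add]
    · exact hval α hα
    · rw [eval_pow]
      refine pow_ne_zero e ?_
      change (map (algebraMap C K) s).eval α ≠ 0
      rw [eval_map_algebraMap]
      exact fun h => hα (by obtain ⟨t, ht⟩ := hs; rw [ht, map_mul, h, zero_mul])

/-- These properties hold for both initial values and survive a replacement: integrality is part of
membership in `E`, and division by a polynomial can only lower the order of vanishing of the `D ^ d`
coefficient. -/
theorem IsCurrent.isCandidate (hB : IsOrderBasis ι L d B) (hBC : ∀ i < d, (B i).DefinedOver C)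
    {s : C[X]} (hs : IsSquarefreePart s L.leadingCoeff) {Y : OpQuotient (baseChange K L)}
    (hY : IsCurrent ι L s d B Y) : IsCandidate ι L d Y := by
  have hd := hB.pos
  have hs0 : s ≠ 0 := hs.1.ne_zero
  induction hY with
  | init =>
    have h1 : d - 1 < d := by omega
    have hD := definedOver_smul_D_pow (hBC _ h1) s 1
    have hl := hasLeading_smul_D_pow (hB.hasLeading hs h1) hs0 hs.2.1 1 1
    rw [pow_one] at hD
    rw [pow_one, pow_one, Nat.sub_add_cancel hd] at hl
    exact ⟨hD, (hB.isIntegral h1).smul_D_smul hB.leadingCoeff_ne_zero hs, hl⟩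
  | init_alt =>
    have hD := definedOver_smul_D_pow (hBC 0 hd) (s ^ d) d
    have hl := hasLeading_smul_D_pow (hB.hasLeading hs hd) hs0 hs.2.1 d d
    rw [map_pow] at hD
    rw [zero_add] at hl
    exact ⟨hD, (hB.isIntegral hd).pow_smul_D_pow_smul hB.leadingCoeff_ne_zero hs d, hl⟩
  | step Y p a hY hp hE ih =>
    obtain ⟨⟨Q, hQ⟩, -, P, hP, hord, h0, hval⟩ := ih
    have hp' : algebraMap K[X] (RatFunc K) (polyInc K p) ≠ 0 := RatFunc.algebraMap_ne_zero
      ((Polynomial.map_ne_zero_iff (algebraMap C K).injective).2 hp)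
    refine ⟨?_, hE.1.1, ?_⟩
    · choose! T hT using hBC
      refine ⟨(algebraMap C[X] (RatFunc C) p)⁻¹ •
        (∑ i ∈ Finset.range d, algebraMap C[X] (RatFunc C) (a i) • T i + Q), ?_⟩
      rw [refinement_eq_combination, combination_eq_mk (fun i hi => (hT i hi).symm) hQ.symm,
        DiffOp.map_smul, DiffOp.map_add, DiffOp.map_sum, map_inv₀, ratInc_algebraMap]
      simp only [DiffOp.map_smul, ratInc_algebraMap]
    · obtain ⟨R, hR, hRord, hRc⟩ := hB.exists_combination_eq_mk hP hord
        (algebraMap K[X] (RatFunc K) (polyInc K p))⁻¹ fun i => polyInc K (a i)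
      refine ⟨R, hR, hRord, ?_, fun α hα => ?_⟩
      · rw [hRc]
        exact mul_ne_zero (inv_ne_zero hp') h0
      · rw [hRc, valAt_mul α (inv_ne_zero hp') h0, valAt_inv α hp']
        have h1 := hval α hα
        have h2 := valAt_algebraMap_nonneg α (polyInc K p)
        omega

end Basis

/-! ### The element with a denominator of degree one -/

/-- Linear factors are stripped from `q` until the multiple of `A` leaves `N`. -/
theorem Submodule.exists_X_sub_C_smul_mem {K M : Type*} [Field K] [IsAlgClosed K] [AddCommGroup M]
    [Module K[X] M] (N : Submodule K[X] M) {A : M} (hA : A ∉ N) (q : K[X]) (hq : q ≠ 0)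
    (hqA : q • A ∈ N) : ∃ (q' : K[X]) (α : K), q' • A ∉ N ∧ (X - C α) • q' • A ∈ N := by
  induction h : q.natDegree generalizing q with
  | zero =>
    obtain ⟨c, rfl⟩ := natDegree_eq_zero.1 h
    have hc : c ≠ 0 := fun h0 => hq (by rw [h0, C_0])
    refine absurd ?_ hA
    have h1 := N.smul_mem (C c⁻¹) hqA
    rwa [smul_smul, ← C_mul, inv_mul_cancel₀ hc, C_1, one_smul] at h1
  | succ n ih =>
    obtain ⟨α, hα⟩ := IsAlgClosed.exists_root q
      (by rw [degree_eq_natDegree hq, h]; exact_mod_cast Nat.succ_ne_zero n)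
    obtain ⟨q₁, rfl⟩ := dvd_iff_isRoot.2 hα
    have hq₁ : q₁ ≠ 0 := right_ne_zero_of_mul hq
    rw [natDegree_mul (X_sub_C_ne_zero α) hq₁, natDegree_X_sub_C] at h
    by_cases hmem : q₁ • A ∈ N
    · exact ih q₁ hq₁ hmem (by omega)
    · exact ⟨q₁, α, hmem, by rwa [smul_smul]⟩

theorem Polynomial.exists_eq_C_eval_add {K : Type*} [Field K] (α : K) (p : K[X]) :
    ∃ q : K[X], p = C (p.eval α) + (X - C α) * q := by
  obtain ⟨q, hq⟩ := X_sub_C_dvd_sub_C_eval (a := α) (p := p)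
  exact ⟨q, by rw [← hq]; ring⟩

section SimplePole

variable {C K : Type*} [Field C] [CharZero C] [Field K] [Algebra C K] {ι : Threshold C}
  {L : DiffOp C[X]} {d : ℕ} {B : ℕ → OpQuotient (baseChange K L)} {Y : OpQuotient (baseChange K L)}

/-- The element `1 / (x - α) * (a₀ B₀ + ⋯ + a_{d-1} B_{d-1} + Y)` for constants `aᵢ`. -/
noncomputable def simplePole (d : ℕ) (B : ℕ → OpQuotient (baseChange K L))
    (Y : OpQuotient (baseChange K L)) (α : K) (a : ℕ → K) : OpQuotient (baseChange K L) :=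
  combination d B Y (algebraMap K[X] (RatFunc K) (X - Polynomial.C α))⁻¹ fun i =>
    Polynomial.C (a i)

omit [CharZero C] in
theorem mem_span_insert_basis_iff {A : OpQuotient (baseChange K L)} :
    A ∈ Submodule.span K[X] (insert Y (B '' Set.Iio d)) ↔
      ∃ (u : K[X]) (c : ℕ → K[X]), A = u • Y + ∑ i ∈ Finset.range d, c i • B i := by
  rw [Submodule.mem_span_insert]
  constructor
  · rintro ⟨u, z, hz, rfl⟩
    obtain ⟨c, rfl⟩ := Submodule.mem_span_image_Iio.1 hz
    exact ⟨u, c, rfl⟩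
  · rintro ⟨u, c, rfl⟩
    exact ⟨u, _, Submodule.mem_span_image_Iio.2 ⟨c, rfl⟩, rfl⟩

/-- The `D ^ d` coefficients of `A` and `Y` are proportional over `K(x)`; cross-multiplying by
numerator and denominator of the ratio leaves an integral element of order below `d`. -/
theorem exists_smul_mem_span (hB : IsOrderBasis ι L d B) (hY : IsCandidate ι L d Y)
    {A : OpQuotient (baseChange K L)} (hA : A.IsIntegral ι) (hord : A.ord ≤ d) :
    ∃ q : K[X], q ≠ 0 ∧ q • A ∈ Submodule.span K[X] (insert Y (B '' Set.Iio d)) := by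
  obtain ⟨P, hP, hPord⟩ := A.exists_mk_eq
  obtain ⟨Q, hQ, hQord, hQ0, -⟩ := hY.hasLeading
  set g := P.coeff d / Q.coeff d with hg
  have hden := RatFunc.algebraMap_ne_zero g.denom_ne_zero
  have hmk : OpQuotient.mk (algebraMap K[X] (RatFunc K) g.denom • P -
      algebraMap K[X] (RatFunc K) g.num • Q) = g.denom • A - g.num • Y := by
    rw [OpQuotient.mk_sub, OpQuotient.mk_smul, OpQuotient.mk_smul, hP, hQ,
      OpQuotient.polynomial_smul, OpQuotient.polynomial_smul]
  have hc : (algebraMap K[X] (RatFunc K) g.denom • P -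
      algebraMap K[X] (RatFunc K) g.num • Q).coeff d = 0 := by
    rw [DiffOp.coeff_sub, DiffOp.coeff_smul, DiffOp.coeff_smul]
    have h1 : g * Q.coeff d = P.coeff d := div_mul_cancel₀ _ hQ0
    have h2 : algebraMap K[X] (RatFunc K) g.num = g * algebraMap K[X] (RatFunc K) g.denom :=
      (div_eq_iff hden).1 g.num_div_denom
    rw [h2, ← h1]
    ring
  have hlt := DiffOp.order_lt_of_coeff_eq_zero hB.pos (DiffOp.order_sub_le
    (DiffOp.order_smul_le _ (hPord.le.trans hord)) (DiffOp.order_smul_le _ hQord)) hc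
  obtain ⟨c, hc⟩ := hB.exists_eq_sum ((hA.polynomial_smul g.denom).sub
    (hY.isIntegral.polynomial_smul g.num)) (by
      rw [← hmk]; exact (OpQuotient.ord_mk_le _).trans_lt hlt)
  refine ⟨g.denom, g.denom_ne_zero, mem_span_insert_basis_iff.2 ⟨g.num, c, ?_⟩⟩
  rw [hc]
  abel

omit [CharZero C] in
theorem ord_smul_le (g : RatFunc K) {A : OpQuotient (baseChange K L)} {n : ℕ} (h : A.ord ≤ n) :
    (g • A).ord ≤ n := by
  obtain ⟨P, rfl, hord⟩ := A.exists_mk_eq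
  rw [← OpQuotient.mk_smul]
  exact (OpQuotient.ord_mk_le _).trans (DiffOp.order_smul_le _ (hord.le.trans h))

omit [CharZero C] in
theorem IsOrderBasis.ord_sum_lt (hB : IsOrderBasis ι L d B) (c : ℕ → K[X]) :
    (∑ i ∈ Finset.range d, c i • B i).ord < d := by
  obtain ⟨P, hP, hord, -⟩ := hB.exists_operators
  have h : ∑ i ∈ Finset.range d, c i • B i = OpQuotient.mk (∑ i ∈ Finset.range d,
      algebraMap K[X] (RatFunc K) (c i) • P i) := by
    rw [OpQuotient.mk_sum]
    refine Finset.sum_congr rfl fun i _ => ?_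
    rw [OpQuotient.mk_smul, hP, OpQuotient.polynomial_smul]
  rw [h]
  refine (OpQuotient.ord_mk_le _).trans_lt (Nat.lt_of_le_pred hB.pos
    (DiffOp.order_sum_le fun i hi => ?_))
  rw [Finset.mem_range] at hi
  refine DiffOp.order_smul_le _ ?_
  rw [hord i hi, Nat.pred_eq_sub_one]
  omega

omit [CharZero C] in
theorem X_sub_C_inv_smul_smul (α : K) (A : OpQuotient (baseChange K L)) :
    (algebraMap K[X] (RatFunc K) (X - Polynomial.C α))⁻¹ • (X - Polynomial.C α) • A = A := by
  rw [OpQuotient.polynomial_smul, smul_smul,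
    inv_mul_cancel₀ (RatFunc.algebraMap_ne_zero (X_sub_C_ne_zero α)), one_smul]

omit [CharZero C] in
theorem X_sub_C_smul_inv_smul (α : K) (A : OpQuotient (baseChange K L)) :
    (X - Polynomial.C α) • (algebraMap K[X] (RatFunc K) (X - Polynomial.C α))⁻¹ • A = A := by
  rw [OpQuotient.polynomial_smul, smul_smul,
    mul_inv_cancel₀ (RatFunc.algebraMap_ne_zero (X_sub_C_ne_zero α)), one_smul]

theorem exists_simplePole_isIntegral [IsAlgClosed K] (hB : IsOrderBasis ι L d B)
    (hY : IsCandidate ι L d Y) (hE : (missing ι d B Y).Nonempty) :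
    ∃ (α : K) (a : ℕ → K), (simplePole d B Y α a).IsIntegral ι := by
  obtain ⟨A, ⟨hA, hAord⟩, hAM⟩ := hE
  obtain ⟨q, hq, hqA⟩ := exists_smul_mem_span hB hY hA hAord
  obtain ⟨q', α, hA₁, hA₁M⟩ := Submodule.exists_X_sub_C_smul_mem _ hAM q hq hqA
  obtain ⟨u, c, huc⟩ := mem_span_insert_basis_iff.1 hA₁M
  -- The parts of the coefficients divisible by `x - α` yield elements of the span after division,
  -- so they may be subtracted; constants remain.
  obtain ⟨u', hu'⟩ := Polynomial.exists_eq_C_eval_add α u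
  choose c' hc' using fun i => Polynomial.exists_eq_C_eval_add α (c i)
  set u₀ := u.eval α
  set S := ∑ i ∈ Finset.range d, c' i • B i
  set A₂ := q' • A - u' • Y - S with hA₂
  have hA₂int : A₂.IsIntegral ι :=
    ((hA.polynomial_smul q').sub (hY.isIntegral.polynomial_smul u')).sub
      (.sum fun i hi => (hB.isIntegral (Finset.mem_range.1 hi)).polynomial_smul _)
  have hS : u' • Y + S ∈ Submodule.span K[X] (insert Y (B '' Set.Iio d)) :=
    mem_span_insert_basis_iff.2 ⟨u', c', rfl⟩
  have hA₂M : A₂ ∉ Submodule.span K[X] (insert Y (B '' Set.Iio d)) := fun h => hA₁ (by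
    have := Submodule.add_mem _ h hS
    rwa [hA₂, show q' • A - u' • Y - S + (u' • Y + S) = q' • A by abel] at this)
  have hXA₂ : (X - Polynomial.C α) • A₂ =
      Polynomial.C u₀ • Y + ∑ i ∈ Finset.range d, Polynomial.C ((c i).eval α) • B i := by
    have h1 : ∑ i ∈ Finset.range d, c i • B i =
        ∑ i ∈ Finset.range d, Polynomial.C ((c i).eval α) • B i + (X - Polynomial.C α) • S := by
      rw [Finset.smul_sum, ← Finset.sum_add_distrib]
      refine Finset.sum_congr rfl fun i _ => ?_
      conv_lhs => rw [hc' i]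
      rw [add_smul, mul_smul]
    rw [hA₂, smul_sub, smul_sub, huc, h1]
    conv_lhs => rw [hu']
    rw [add_smul, mul_smul]
    abel
  -- Without the `Y` term, `A₂` would have order below `d` and lie in the span.
  have hu₀ : u₀ ≠ 0 := fun h0 => by
    rw [h0, C_0, zero_smul, zero_add] at hXA₂
    have h1 := X_sub_C_inv_smul_smul α A₂
    rw [hXA₂] at h1
    have h2 : A₂.ord < d := by
      have h3 := hB.ord_sum_lt fun i => Polynomial.C ((c i).eval α)
      rw [← h1]
      have h4 := ord_smul_le (algebraMap K[X] (RatFunc K) (X - Polynomial.C α))⁻¹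
        (Nat.le_pred_of_lt h3)
      have := hB.pos
      rw [Nat.pred_eq_sub_one] at h4
      omega
    obtain ⟨b, hb⟩ := hB.exists_eq_sum hA₂int h2
    exact hA₂M (mem_span_insert_basis_iff.2 ⟨0, b, by rw [hb, zero_smul, zero_add]⟩)
  refine ⟨α, fun i => u₀⁻¹ * (c i).eval α, ?_⟩
  have h := hA₂int.polynomial_smul (Polynomial.C u₀⁻¹)
  convert h using 1
  rw [simplePole, combination, ← X_sub_C_inv_smul_smul α (Polynomial.C u₀⁻¹ • A₂)]
  congr 1
  rw [smul_comm, hXA₂, smul_add, smul_smul, ← C_mul, inv_mul_cancel₀ hu₀, C_1, one_smul,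
    Finset.smul_sum, add_comm]
  congr 1
  refine Finset.sum_congr rfl fun i _ => ?_
  rw [smul_smul, ← C_mul]

/-- The pole of such an integral element is a root of the leading coefficient of `L`. -/
theorem aeval_leadingCoeff_eq_zero (hB : IsOrderBasis ι L d B) (hY : IsCandidate ι L d Y) {α : K}
    {a : ℕ → K} (h : (simplePole d B Y α a).IsIntegral ι) : aeval α L.leadingCoeff = 0 := by
  by_contra hα
  obtain ⟨Q, hQ, hQord, hQ0, hval⟩ := hY.hasLeading
  obtain ⟨R, hR, hRord, hRc⟩ := hB.exists_combination_eq_mk hQ hQord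
    (algebraMap K[X] (RatFunc K) (X - Polynomial.C α))⁻¹ fun i => Polynomial.C (a i)
  rw [simplePole, ← hR] at h
  -- An integral element has no pole at an ordinary point, but dividing by `x - α` has made the
  -- order of the `D ^ d` coefficient negative.
  have h1 := h.valAt_nonneg (hRord.trans_lt hB.lt_order) hα d
  have hx := RatFunc.algebraMap_ne_zero (X_sub_C_ne_zero α)
  rw [hRc, valAt_mul α (inv_ne_zero hx) hQ0, valAt_inv α hx, valAt_X_sub_C] at h1
  have h2 := hval α hα
  omega

/-- The constants are determined by the pole. -/
theorem simplePole_unique (hB : IsOrderBasis ι L d B) {α : K} {a a' : ℕ → K}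
    (h : (simplePole d B Y α a).IsIntegral ι) (h' : (simplePole d B Y α a').IsIntegral ι) {i : ℕ}
    (hi : i < d) : a i = a' i := by
  have hdiff : (X - Polynomial.C α) • (simplePole d B Y α a - simplePole d B Y α a') =
      ∑ i ∈ Finset.range d, Polynomial.C (a i - a' i) • B i := by
    rw [smul_sub, simplePole, simplePole, combination, combination, X_sub_C_smul_inv_smul,
      X_sub_C_smul_inv_smul, add_sub_add_right_eq_sub, ← Finset.sum_sub_distrib]
    refine Finset.sum_congr rfl fun i _ => ?_
    rw [C_sub, sub_smul]
  have hord : (simplePole d B Y α a - simplePole d B Y α a').ord < d := by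
    rw [← X_sub_C_inv_smul_smul α (simplePole d B Y α a - simplePole d B Y α a'), hdiff]
    have h3 := hB.ord_sum_lt fun i => Polynomial.C (a i - a' i)
    have h4 := ord_smul_le (algebraMap K[X] (RatFunc K) (X - Polynomial.C α))⁻¹
      (Nat.le_pred_of_lt h3)
    have := hB.pos
    rw [Nat.pred_eq_sub_one] at h4
    omega
  -- The `Y` terms cancel in the difference, which is therefore a polynomial combination of the
  -- `Bᵢ`. So `x - α` divides each constant `a i - a' i`.
  obtain ⟨c, hc⟩ := hB.exists_eq_sum (h.sub h') hord
  rw [← hc, Finset.smul_sum] at hdiff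
  simp only [smul_smul] at hdiff
  have h5 := congrArg (eval α) (hB.linearIndependent.eq_of_sum_range hdiff hi)
  simpa [sub_eq_zero, eq_comm] using h5

/-! ### Descent from `K` to `C` -/

/-- The operators `L`, `Bᵢ` and `Y` are defined over `C`, so conjugation moves only `α` and the
constants. -/
theorem simplePole_map (hBC : ∀ i < d, (B i).DefinedOver C) (hY : Y.DefinedOver C) {α : K}
    {a : ℕ → K} (h : (simplePole d B Y α a).IsIntegral ι) (σ : K ≃ₐ[C] K) :
    (simplePole d B Y (σ α) fun i => σ (a i)).IsIntegral ι := by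
  choose! T hT using hBC
  obtain ⟨Q, hQ⟩ := hY
  rw [simplePole, combination_eq_mk (fun i hi => (hT i hi).symm) hQ.symm,
    OpQuotient.isIntegral_mk_iff] at h ⊢
  intro β
  have h1 := (h (σ.symm β)).map σ (baseChange_map L σ)
  rw [AlgEquiv.apply_symm_apply] at h1
  convert h1 using 1
  rw [DiffOp.map_smul, DiffOp.map_add, DiffOp.map_sum, map_ratInc_map, map_inv₀,
    ratMap_algebraMap]
  simp only [DiffOp.map_smul, map_ratInc_map, ratMap_algebraMap, Polynomial.map_sub, map_X, map_C]
  rfl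

/-- An automorphism over `C(α)` keeps the pole, hence by uniqueness the constants, so these lie in
`C(α) = C[α]`. Reduction modulo the minimal polynomial gives the degree bound. -/
theorem exists_aeval_eq_of_simplePole [IsAlgClosed K] (hB : IsOrderBasis ι L d B)
    (hBC : ∀ i < d, (B i).DefinedOver C) (hY : Y.DefinedOver C) {α : K} {a : ℕ → K}
    (hα : IsIntegral C α) (h : (simplePole d B Y α a).IsIntegral ι) {i : ℕ} (hi : i < d) :
    ∃ q : C[X], q.degree < (minpoly C α).degree ∧ aeval α q = a i := by
  let F := IntermediateField.adjoin C {α}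
  have hF : CharZero F := charZero_of_injective_algebraMap (algebraMap C F).injective
  obtain ⟨y, hy⟩ := IsAlgClosed.mem_range_algebraMap_of_fixed (F := F) (x := a i) fun σ => by
    have h1 := simplePole_map hBC hY h (σ.restrictScalars C)
    have h2 : σ.restrictScalars C α = α :=
      σ.commutes ⟨α, IntermediateField.mem_adjoin_simple_self C α⟩
    rw [h2] at h1
    exact simplePole_unique hB h1 h hi
  have hmem : a i ∈ F.toSubalgebra := hy ▸ y.2
  rw [IntermediateField.adjoin_simple_toSubalgebra_of_isAlgebraic hα.isAlgebraic,
    Algebra.adjoin_singleton_eq_range_aeval] at hmem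
  obtain ⟨q, hq⟩ := hmem
  refine ⟨q %ₘ minpoly C α, degree_modByMonic_lt _ (minpoly.monic hα), ?_⟩
  rw [← hq]
  exact aeval_modByMonic_eq_self_of_root (minpoly.aeval C α)

/-- The roots of `p` are simple and conjugate to `α`. At a root `β = σ α` write `p = (x - β) p₁`
with `p₁(β) ≠ 0`. The polynomial `aᵢ` differs from the constant `aᵢ(β) = σ(aᵢ(α))` by a multiple of
`x - β`, so the element is `1 / p₁` times the sum of the conjugate simple pole and a polynomial
combination of the `Bᵢ`. Elsewhere `1 / p` has no pole. -/
theorem refinement_isIntegral [IsAlgClosed K] (hB : IsOrderBasis ι L d B)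
    (hBC : ∀ i < d, (B i).DefinedOver C) (hY : IsCandidate ι L d Y) {α : K} (hα : IsIntegral C α)
    {a : ℕ → C[X]} (h : (simplePole d B Y α fun i => aeval α (a i)).IsIntegral ι) :
    (refinement d B Y (minpoly C α) a).IsIntegral ι := by
  obtain ⟨P, hP, -⟩ := hB.exists_operators
  obtain ⟨Q, hQ, -⟩ := hY.hasLeading
  set p := polyInc K (minpoly C α) with hp
  have hp0 : p ≠ 0 :=
    (Polynomial.map_ne_zero_iff (algebraMap C K).injective).2 (minpoly.ne_zero hα)
  have hsq : Squarefree p := (minpoly.irreducible hα).separable.map.squarefree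
  have hPint : ∀ i ∈ Finset.range d, ∀ β, IntegralAt ι (baseChange K L) β (P i) := fun i hi => by
    have := hB.isIntegral (Finset.mem_range.1 hi)
    rwa [← hP, OpQuotient.isIntegral_mk_iff] at this
  have hQint : ∀ β, IntegralAt ι (baseChange K L) β Q := by
    have := hY.isIntegral
    rwa [← hQ, OpQuotient.isIntegral_mk_iff] at this
  rw [refinement_eq_combination, combination_eq_mk (fun i _ => hP i) hQ,
    OpQuotient.isIntegral_mk_iff]
  intro β
  have hpoly : ∀ (q : K[X]), ∀ k < 0, (expandAt β (algebraMap K[X] (RatFunc K) q)).coeff k = 0 :=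
    fun q k hk => coeff_expandAt_algebraMap_of_neg β q hk
  have hinv : ∀ q : K[X], q.eval β ≠ 0 →
      ∀ k < 0, (expandAt β (algebraMap K[X] (RatFunc K) q)⁻¹).coeff k = 0 := fun q hq => by
    have hq0 : q ≠ 0 := fun h0 => hq (by rw [h0, eval_zero])
    rw [← valAt_nonneg_iff, valAt_inv β (RatFunc.algebraMap_ne_zero hq0),
      valAt_algebraMap_of_eval_ne_zero hq, neg_zero]
  by_cases hβ : p.eval β = 0
  · have hroot : aeval β (minpoly C α) = 0 := by
      rw [← eval_map_algebraMap]; exact hβ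
    obtain ⟨σ, rfl⟩ := IsAlgClosed.exists_algEquiv_of_root hα.isAlgebraic hroot
    set β := σ α
    have h1 := simplePole_map hBC hY.definedOver h σ
    rw [simplePole, combination_eq_mk (fun i _ => hP i) hQ, OpQuotient.isIntegral_mk_iff] at h1
    have h2 := h1 β
    obtain ⟨p₁, hp₁⟩ := dvd_iff_isRoot.2 (show p.IsRoot β from hβ)
    have hp₁β : p₁.eval β ≠ 0 := fun h0 => by
      obtain ⟨p₂, rfl⟩ := dvd_iff_isRoot.2 (show p₁.IsRoot β from h0)
      exact not_isUnit_X_sub_C β (hsq _ ⟨p₂, by rw [hp₁]; ring⟩)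
    have heval : ∀ i, σ (aeval α (a i)) = (polyInc K (a i)).eval β := fun i => by
      change _ = (map (algebraMap C K) (a i)).eval (σ α)
      rw [eval_map_algebraMap, aeval_algHom_apply]
    choose r hr using fun i => Polynomial.exists_eq_C_eval_add β (polyInc K (a i))
    have h3 : IntegralAt ι (baseChange K L) β
        (∑ i ∈ Finset.range d, algebraMap K[X] (RatFunc K) (r i) • P i) :=
      .sum fun i hi => (hPint i hi β).smul (hpoly _)
    convert (h2.add h3).smul (hinv p₁ hp₁β) using 1
    have hx := RatFunc.algebraMap_ne_zero (X_sub_C_ne_zero β)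
    have h4 : ∑ i ∈ Finset.range d, algebraMap K[X] (RatFunc K) (polyInc K (a i)) • P i =
        ∑ i ∈ Finset.range d,
          algebraMap K[X] (RatFunc K) (Polynomial.C ((polyInc K (a i)).eval β)) • P i +
        algebraMap K[X] (RatFunc K) (X - Polynomial.C β) •
          ∑ i ∈ Finset.range d, algebraMap K[X] (RatFunc K) (r i) • P i := by
      rw [Finset.smul_sum, ← Finset.sum_add_distrib]
      refine Finset.sum_congr rfl fun i _ => ?_
      conv_lhs => rw [hr i]
      rw [map_add, add_smul, map_mul, mul_smul]
    simp only [heval]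
    rw [h4, ← hp, hp₁, map_mul, mul_inv, mul_comm, mul_smul]
    congr 1
    rw [add_right_comm, smul_add _ (_ + Q), smul_smul, inv_mul_cancel₀ hx, one_smul]
  · exact ((IntegralAt.sum fun i hi => (hPint i hi β).smul (hpoly _)).add (hQint β)).smul
      (hinv p hβ)

omit [CharZero C] in
-- Comparing `D ^ d` coefficients would make `1 / p` a polynomial, whereas an irreducible `p` is not
-- constant.
theorem refinement_notMem_span (hB : IsOrderBasis ι L d B) (hY : HasLeading L d Y) {p : C[X]}
    (hp : Irreducible p) (a : ℕ → C[X]) :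
    refinement d B Y p a ∉ Submodule.span K[X] (insert Y (B '' Set.Iio d)) := by
  intro hmem
  obtain ⟨u, c, huc⟩ := mem_span_insert_basis_iff.1 hmem
  obtain ⟨Q, hQ, hQord, hQ0, -⟩ := hY
  have hp0 : polyInc K p ≠ 0 :=
    (Polynomial.map_ne_zero_iff (algebraMap C K).injective).2 hp.ne_zero
  have hp0' := RatFunc.algebraMap_ne_zero hp0
  obtain ⟨R, hR, hRord, hRc⟩ := hB.exists_combination_eq_mk hQ hQord
    (algebraMap K[X] (RatFunc K) (polyInc K p))⁻¹ fun i => polyInc K (a i)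
  obtain ⟨S, hS, hSord⟩ := (∑ i ∈ Finset.range d, c i • B i).exists_mk_eq
  have hSlt := hB.ord_sum_lt c
  rw [← hSord] at hSlt
  have hop : R = algebraMap K[X] (RatFunc K) u • Q + S := by
    refine OpQuotient.eq_of_mk_eq_mk (L := baseChange K L) ?_ ?_ ?_
    · rw [hR, ← refinement_eq_combination, huc, OpQuotient.mk_add, OpQuotient.mk_smul, hQ, hS,
        OpQuotient.polynomial_smul]
    · rw [order_baseChange]
      exact hRord.trans_lt hB.lt_order
    · rw [order_baseChange]
      exact (DiffOp.order_add_le (DiffOp.order_smul_le _ hQord) hSlt.le).trans_lt hB.lt_order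
  have hcoeff := congrArg (fun T => DiffOp.coeff T d) hop
  simp only [hRc, DiffOp.coeff_add, DiffOp.coeff_smul, DiffOp.coeff_eq_zero_of_order_lt hSlt,
    add_zero] at hcoeff
  have h1 := mul_right_cancel₀ hQ0 hcoeff
  have h2 : polyInc K p * u = 1 := by
    apply RatFunc.algebraMap_injective K
    rw [map_mul, ← h1, mul_inv_cancel₀ hp0', map_one]
  have h3 : IsUnit (polyInc K p) := IsUnit.of_mul_eq_one u h2
  have h4 : p.natDegree = 0 := by
    rw [← natDegree_map (algebraMap C K)]
    exact natDegree_eq_zero_of_isUnit h3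
  exact hp.natDegree_pos.ne' h4

end SimplePole

/-! ### The theorem -/

theorem mainTheorem1 {C K : Type*} [Field C] [CharZero C] [Field K] [IsAlgClosed K] [Algebra C K]
    (ι : Threshold C)
    (L : DiffOp C[X]) (hL : IsRegularOp C (baseChange K L))
    (s : C[X]) (hs : IsSquarefreePart s L.leadingCoeff)
    (d : ℕ) (hd : 1 ≤ d) (hdr : d < L.order)
    (B : ℕ → OpQuotient (baseChange K L))
    (hBC : ∀ i < d, (B i).DefinedOver C)
    (hord : ∀ i < d, (B i).ord = i)
    (hindep : LinearIndependent K[X] fun i : Fin d => B i)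
    (hspan : (Submodule.span K[X] (B '' Set.Iio d) : Set (OpQuotient (baseChange K L))) =
      {A | A.IsIntegral ι ∧ A.ord < d})
    (hBd : IsCurrent ι L s d B (B d))
    (hE : (missing ι d B (B d)).Nonempty) :
    ∃ (p : C[X]) (a : ℕ → C[X]),
      Irreducible p ∧ p ∣ L.leadingCoeff ∧ (∀ i < d, (a i).degree < p.degree) ∧
        refinement d B (B d) p a ∈ missing ι d B (B d) := by
  have hB : IsOrderBasis ι L d B := ⟨hd, hdr, hord, hindep, hspan⟩
  have hY : IsCandidate ι L d (B d) := hBd.isCandidate hB hBC hs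
  obtain ⟨α, b, hb⟩ := exists_simplePole_isIntegral hB hY hE
  have hα := aeval_leadingCoeff_eq_zero hB hY hb
  have hint : IsIntegral C α := isAlgebraic_iff_isIntegral.1 ⟨_, hB.leadingCoeff_ne_zero, hα⟩
  choose! a hadeg ha using fun i (hi : i < d) =>
    exists_aeval_eq_of_simplePole hB hBC hY.definedOver hint hb hi
  have hb' : (simplePole d B (B d) α fun i => aeval α (a i)).IsIntegral ι := by
    convert hb using 1
    rw [simplePole, simplePole, combination, combination]
    congr 2
    refine Finset.sum_congr rfl fun i hi => ?_
    rw [ha i (Finset.mem_range.1 hi)]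
  obtain ⟨Q, hQ, hQord, -⟩ := hY.hasLeading
  obtain ⟨R, hR, hRord, -⟩ := hB.exists_combination_eq_mk hQ hQord
    (algebraMap K[X] (RatFunc K) (polyInc K (minpoly C α)))⁻¹ fun i => polyInc K (a i)
  -- The denominator is the minimal polynomial of the pole; it divides `ℓ_r` because `α` is a root.
  refine ⟨minpoly C α, a, minpoly.irreducible hint, minpoly.dvd C α hα, hadeg,
    ⟨refinement_isIntegral hB hBC hY hint hb', ?_⟩,
    refinement_notMem_span hB hY.hasLeading (minpoly.irreducible hint) a⟩
  rw [refinement_eq_combination, ← hR]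
  exact (OpQuotient.ord_mk_le R).trans hRord
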